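/- **Model.** Fix densities $\lambda_1,\lambda_2,\lambda_u>0$ (base stations (BSs) of tiers $1,2$; users), transmit powers $P_1,P_2,P_u>0$, noise power $\sigma^2>0$, path loss exponent $\alpha>2$, residual self-interferences $RSI_1,RSI_2,RSI_u\ge 0$, and received power thresholds $\gamma_1,\gamma_2\in[0,\infty]$. Write $\bar k$ for the tier other than $k$ and $\delta_k=(P_k/\gamma_k)^{1/\alpha}\in[0,\infty]$. The typical user sits at the origin of $\mathbb R^2$. The BSs of the two tiers form independent homogeneous Poisson processes of densities $\lambda_1,\lambda_2$, and $D_k$ is the distance from the typical user to the closest BS of tier $k$. The user belongs to tier $k$ if $D_k\le D_{\bar k}(P_k/P_{\bar k})^{1/\alpha}$ (event of probability $\mathcal A_k$), and is then full-duplex if $D_k\le\delta_k$ (probability of both: $\mathcal A_k^{FD}$) and half-duplex if $D_k>\delta_k$ (probability $\mathcal A_k^{HD}$). Put $\lambda_t^{FD}=\lambda_t\mathcal A_t^{FD}/\mathcal A_t$ and $\lambda_t^{HD}=\lambda_t\mathcal A_t^{HD}/\mathcal A_t$. Conditionally on the user being in tier $k$ in a given duplex mode and on $D_k=r$, the interfering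 nodes of each tier $t$ (BSs scheduling full-duplex users $\Phi_t^{FD}$, BSs scheduling half-duplex users $\Phi_t^{HD}$, full-duplex users $\Phi_{u,t}^{FD}$, half-duplex users $\Phi_{u,t}^{HD}$) form mutually independent Poisson processes whose intensities at distance $y$ from the origin are, with $\zeta=(r+y)/\max\{(P_k/P_t)^{1/\alpha}-1,0\}$, - $\Phi_t^{FD}$: $\lambda_t^{FD}(1-e^{-\lambda_u\pi\zeta^2})$ for $y>r(P_t/P_k)^{1/\alpha}$; - $\Phi_t^{HD}$: $\lambda_t^{HD}(1-e^{-\lambda_u\pi(\zeta^2-\delta_t^2)})$ for $y>r(P_t/P_k)^{1/\alpha}$ and $\zeta>\delta_t$; - $\Phi_{u,t}^{FD}$: $\lambda_t^{FD}(1-e^{-\pi(r+y)^2\lambda_t(P_t/P_k)^{2/\alpha}})$ for $y>\max\{r(P_t/P_k)^{1/\alpha}-\delta_t,0\}$; - $\Phi_{u,t}^{HD}$: $\lambda_t^{HD}(1-e^{-\pi(r+y)^2\lambda_t(P_t/P_k)^{2/\alpha}})$ for $y>\max\{\delta_t(P_k/P_t)^{1/\alpha}-r,0\}$; and $0$ elsewhere.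 The fading coefficients of all links are i.i.d. $\exp(1)$ and independent of these processes. For a kind $\Phi$ of interfering nodes with transmit power $P$ let $J(\Phi)=\sum_{x\in\Phi}P\,h_x|x|^{-\alpha}$. The downlink SINRs of a typical user in tier $k$ are $$\theta_k^{i,FD,D}=\frac{P_kh_0D_k^{-\alpha}}{RSI_u+\sum_{t=1,2}I_t^{i}+\sigma^2}\ (i=1,2),\qquad \theta_k^{1,HD}=\frac{P_kh_0D_k^{-\alpha}}{\sum_{t=1,2}I_t^{1}+\sigma^2},$$ $$I_t^1=J(\Phi_t^{FD})+J(\Phi_{u,t}^{FD})+J(\Phi_t^{HD}),\qquad I_t^2=J(\Phi_t^{FD})+J(\Phi_{u,t}^{FD})+J(\Phi_{u,t}^{HD})$$ on channel $1$ (downlink channel) and channel $2$ (uplink channel). Let $\mathcal C_k^{i,FD,D}(T)$ and $\mathcal C_k^{1,HD}(T)$ be the conditional probabilities that $\theta_k^{i,FD,D}>T$, resp. $\theta_k^{1,HD}>T$, given that the typical user is a full-duplex, resp. half-duplex, user of tier $k$, and let $$\mathcal C^{i,FD,D}=\frac{\sum_k\mathcal A_k^{FD}\,\mathcal C_k^{i,FD,D}}{\sum_k\mathcal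 A_k^{FD}},\qquad \mathcal C^{1,HD}=\frac{\sum_k\mathcal A_k^{HD}\,\mathcal C_k^{1,HD}}{\sum_k\mathcal A_k^{HD}}.$$ A tilde means that the terms $J(\Phi_{u,t}^{FD})$ (interference from full-duplex users) are omitted from $\theta_k^{i,FD,D}$. **Corollary.** Suppose that the self-interference cancellation is perfect, $RSI_1=RSI_2=RSI_u=0$. Then for every $T\ge0$, every tier $k\in\{1,2\}$ and both channels $i\in\{1,2\}$, $$\widetilde{\mathcal C}_k^{i,FD,D}(T)\big|_{\gamma_1=\gamma_2=0}=\mathcal C_k^{1,HD}(T)\big|_{\gamma_1=\gamma_2=\infty}\quad\text{and}\quad \widetilde{\mathcal C}^{i,FD,D}(T)\big|_{\gamma_1=\gamma_2=0}=\mathcal C^{1,HD}(T)\big|_{\gamma_1=\gamma_2=\infty}.$$ -/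

import Mathlib

open MeasureTheory ProbabilityTheory
open scoped ENNReal NNReal

namespace HetNet

/-- The plane in which base stations and users live. The typical user is at the origin. -/
abbrev Plane : Type := EuclideanSpace ℝ (Fin 2)

/-! ### Point processes in the plane -/

/-- A point process in the plane, as a measurable enumeration of its (finitely or infinitely
many) random points: the points are `pt n ω` for `n < count ω`. -/
structure PointProcess (Ω : Type*) [MeasurableSpace Ω] where
  /-- number of points -/
  count : Ω → ℕ∞
  /-- position of the `n`-th point (meaningful only when `n < count ω`) -/
  pt : ℕ → Ω → Plane
  measurable_count : Measurable count
  measurable_pt : ∀ n, Measurable (pt n)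

namespace PointProcess

variable {Ω : Type*} [MeasurableSpace Ω]

open Classical in
/-- The sum of `f n ω (X n ω)` over the points `X n ω` of the process. -/
noncomputable def sumPoints (X : PointProcess Ω) (f : ℕ → Ω → Plane → ℝ≥0∞) (ω : Ω) : ℝ≥0∞ :=
  ∑' n : ℕ, if (n : ℕ∞) < X.count ω then f n ω (X.pt n ω) else 0

/-- The number of points in the set `B`. -/
noncomputable def numIn (X : PointProcess Ω) (B : Set Plane) (ω : Ω) : ℝ≥0∞ :=
  X.sumPoints (fun _ _ x => B.indicator 1 x) ω

/-- The distance from the origin to the closest point (`∞` if there is no point). -/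
noncomputable def nearest (X : PointProcess Ω) (ω : Ω) : ℝ≥0∞ :=
  ⨅ (n : ℕ) (_ : (n : ℕ∞) < X.count ω), ‖X.pt n ω‖ₑ

/-- The process as one random element: number and positions of its points. -/
def config (X : PointProcess Ω) (ω : Ω) : ℕ∞ × (ℕ → Plane) :=
  (X.count ω, fun n => X.pt n ω)

/-- Under the probability measure `μ`, `X` is a Poisson point process with intensity
measure `Λ`. -/
structure IsPoisson (X : PointProcess Ω) (Λ : Measure Plane) (μ : Measure Ω) : Prop where
  law_numIn : ∀ B : Set Plane, MeasurableSet B → Λ B ≠ ∞ →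
    μ.map (X.numIn B) =
      (poissonMeasure (Λ B).toNNReal).map (Nat.cast : ℕ → ℝ≥0∞)
  indep_numIn : ∀ (n : ℕ) (B : Fin n → Set Plane), (∀ i, MeasurableSet (B i)) →
    Pairwise (fun i j => Disjoint (B i) (B j)) → iIndepFun (fun i => X.numIn (B i)) μ

end PointProcess

/-! ### The network -/

/-- The physical parameters of a two-tier network. Tier `0` is the macro tier and tier `1` is
the small-cell tier. -/
structure Params where
  /-- densities of the base stations of the two tiers -/
  dens : Fin 2 → ℝ≥0
  /-- density of the users -/
  densUser : ℝ≥0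
  /-- transmit powers of the base stations of the two tiers -/
  pow : Fin 2 → ℝ≥0
  /-- transmit power of the users -/
  powUser : ℝ≥0
  /-- residual self-interference of the base stations of the two tiers -/
  rsi : Fin 2 → ℝ≥0
  /-- residual self-interference of the users -/
  rsiUser : ℝ≥0
  /-- thermal noise power -/
  noise : ℝ≥0
  /-- path loss exponent -/
  α : ℝ
  dens_pos : ∀ k, 0 < dens k
  densUser_pos : 0 < densUser
  pow_pos : ∀ k, 0 < pow k
  powUser_pos : 0 < powUser
  noise_pos : 0 < noise
  two_lt_α : 2 < α

/-- The duplex modes. -/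
inductive Duplex
  | full
  | half

/-- The kinds of interfering nodes: base stations scheduling a full- or half-duplex user, and
full- or half-duplex users. -/
inductive Kind
  | bsFull
  | bsHalf
  | userFull
  | userHalf

/-- The random objects of a network seen from the typical user. -/
structure Network (Ω : Type*) [MeasurableSpace Ω] where
  /-- all base stations of tier `k` -/
  bs : Fin 2 → PointProcess Ω
  /-- the interfering nodes of each kind in tier `t` (so without the tagged base station and
  the typical user) -/
  inter : Fin 2 → Kind → PointProcess Ω
  /-- fading from the tagged base station (`none`), resp. from the `n`-th interfering node of a
  given tier and kind, to the typical user -/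
  fading : Option ((Fin 2 × Kind) × ℕ) → Ω → ℝ
  measurable_fading : ∀ i, Measurable (fading i)

namespace Params

/-- The ratio `(P_t / P_k) ^ (1 / α)`. -/
noncomputable def ratio (p : Params) (t k : Fin 2) : ℝ≥0∞ :=
  ((p.pow t : ℝ≥0∞) / p.pow k) ^ (1 / p.α)

/-- The distance `δ_k = (P_k / γ_k) ^ (1 / α)` up to which users of tier `k` are full-duplex,
for received power thresholds `γ_k ∈ [0, ∞]`. -/
noncomputable def fullRadius (p : Params) (γ : Fin 2 → ℝ≥0∞) (k : Fin 2) : ℝ≥0∞ :=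
  ((p.pow k : ℝ≥0∞) / γ k) ^ (1 / p.α)

/-- `ζ = (r + y) / max {(P_k / P_t) ^ (1 / α) - 1, 0}`; the subtraction is the truncated
one of `[0, ∞]`, and the quotient is `∞` when the denominator vanishes and `r + y > 0`. -/
noncomputable def handover (p : Params) (k t : Fin 2) (r y : ℝ≥0∞) : ℝ≥0∞ :=
  (r + y) / (p.ratio k t - 1)

end Params

/-- `exp (-x)` for `x ∈ [0, ∞]`, with `exp (-∞) = 0`. -/
noncomputable def expNeg (x : ℝ≥0∞) : ℝ≥0∞ := EReal.exp (-(x : EReal))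

/-- `π` as an extended nonnegative real. -/
noncomputable def piE : ℝ≥0∞ := ENNReal.ofReal Real.pi

namespace Network

variable {Ω : Type*} [MeasurableSpace Ω]

/-- `D_k`, the distance from the typical user to its closest base station in tier `k`. -/
noncomputable def dist (S : Network Ω) (k : Fin 2) (ω : Ω) : ℝ≥0∞ := (S.bs k).nearest ω

/-- The event that the typical user is associated with tier `k`, i.e.
`D_k ≤ D_k' (P_k / P_k') ^ (1 / α)` for the other tier `k'`. -/
def inTier (p : Params) (S : Network Ω) (k : Fin 2) : Set Ω :=
  {ω | S.dist k ω ≤ S.dist k.rev ω * p.ratio k k.rev}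

/-- The event that the typical user is a user of tier `k` in the given duplex mode. -/
def inMode (p : Params) (γ : Fin 2 → ℝ≥0∞) (S : Network Ω) (k : Fin 2) : Duplex → Set Ω
  | .full => {ω | ω ∈ S.inTier p k ∧ S.dist k ω ≤ p.fullRadius γ k}
  | .half => {ω | ω ∈ S.inTier p k ∧ p.fullRadius γ k < S.dist k ω}

/-- The density of the base stations of tier `t` that schedule a user in the given duplex mode:
the density `λ_t` times the conditional probability that a user of tier `t` is in that mode. -/
noncomputable def modeDens (p : Params) (γ : Fin 2 → ℝ≥0∞) (S : Network Ω) (μ : Measure Ω)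
    (t : Fin 2) (m : Duplex) : ℝ≥0∞ :=
  μ (S.inMode p γ t m) / μ (S.inTier p t) * p.dens t

open Classical in
/-- The intensity functions of the interfering nodes of each kind in tier `t`, at distance `y`
from the typical user, when the typical user is in tier `k` at distance `r` from the tagged base
station. -/
noncomputable def intensity (p : Params) (γ : Fin 2 → ℝ≥0∞) (S : Network Ω) (μ : Measure Ω)
    (k t : Fin 2) (r : ℝ≥0∞) : Kind → ℝ≥0∞ → ℝ≥0∞
  | .bsFull, y => S.modeDens p γ μ t .full *
      (1 - expNeg (p.densUser * piE * p.handover k t r y ^ 2))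
  | .bsHalf, y =>
      if p.handover k t r y ≤ p.fullRadius γ t then 0
      else S.modeDens p γ μ t .half *
        (1 - expNeg (p.densUser * piE * (p.handover k t r y ^ 2 - p.fullRadius γ t ^ 2)))
  | .userFull, y => S.modeDens p γ μ t .full *
      (1 - expNeg (piE * (r + y) ^ 2 * p.dens t * p.ratio t k ^ 2))
  | .userHalf, y => S.modeDens p γ μ t .half *
      (1 - expNeg (piE * (r + y) ^ 2 * p.dens t * p.ratio t k ^ 2))

/-- The least possible distance from the typical user to an interfering node of each kind in tier
`t` (truncated subtraction in `[0, ∞]`, i.e. the maximum of the difference and `0`). -/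
noncomputable def exclusion (p : Params) (γ : Fin 2 → ℝ≥0∞) (k t : Fin 2) (r : ℝ≥0∞) :
    Kind → ℝ≥0∞
  | .bsFull => r * p.ratio t k
  | .bsHalf => r * p.ratio t k
  | .userFull => r * p.ratio t k - p.fullRadius γ t
  | .userHalf => p.fullRadius γ t * p.ratio k t - r

open Classical in
/-- The intensity measure of the interfering nodes of a given kind in tier `t`. -/
noncomputable def intensityMeasure (p : Params) (γ : Fin 2 → ℝ≥0∞) (S : Network Ω)
    (μ : Measure Ω) (k t : Fin 2) (r : ℝ≥0∞) (j : Kind) : Measure Plane :=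
  volume.withDensity fun x =>
    if exclusion p γ k t r j < ‖x‖ₑ then S.intensity p γ μ k t r j ‖x‖ₑ else 0

/-- The law, under `ν`, of interferers and fading when the typical user is in tier `k` at distance
`r` from the tagged base station: the interfering nodes form mutually independent inhomogeneous
Poisson processes; all fading coefficients are independent and exponential with mean one; and the
fading is independent of the positions of the nodes. -/
structure HasInterfererLaw (p : Params) (γ : Fin 2 → ℝ≥0∞) (S : Network Ω) (μ : Measure Ω)
    (k : Fin 2) (r : ℝ≥0∞) (ν : Measure Ω) : Prop where
  poisson : ∀ t j, (S.inter t j).IsPoisson (S.intensityMeasure p γ μ k t r j) ν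
  indep_inter : iIndepFun (fun (i : Fin 2 × Kind) ω => (S.inter i.1 i.2).config ω) ν
  law_fading : ∀ i, ν.map (S.fading i) = expMeasure 1
  indep_fading : iIndepFun S.fading ν
  indep_inter_fading :
    IndepFun (fun ω (i : Fin 2 × Kind) => (S.inter i.1 i.2).config ω)
      (fun ω i => S.fading i ω) ν

/-- `S` is, under `μ`, a hybrid-duplex two-tier network with parameters `p` and received power
thresholds `γ`: the base stations of the tiers form independent homogeneous Poisson processes,
and, given that the typical user is a user of tier `k` in mode `m` and given its distance `D_k` from
the tagged base station, interferers and fading have the law described above. -/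
structure IsModel [StandardBorelSpace Ω] (p : Params) (γ : Fin 2 → ℝ≥0∞) (S : Network Ω)
    (μ : Measure Ω) : Prop where
  poisson_bs : ∀ k, (S.bs k).IsPoisson ((p.dens k : ℝ≥0∞) • volume) μ
  indep_bs : IndepFun (S.bs 0).config (S.bs 1).config μ
  interferers : ∀ (k : Fin 2) (m : Duplex), ∀ᵐ ω ∂(cond μ (S.inMode p γ k m)),
    S.HasInterfererLaw p γ μ k (S.dist k ω)
      (condExpKernel (cond μ (S.inMode p γ k m))
        (MeasurableSpace.comap (S.dist k) inferInstance) ω)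

/-! ### Interference and downlink SINR -/

/-- Transmit power of the interfering nodes of each kind in tier `t`. -/
def kindPow (p : Params) (t : Fin 2) : Kind → ℝ≥0
  | .bsFull => p.pow t
  | .bsHalf => p.pow t
  | .userFull => p.powUser
  | .userHalf => p.powUser

/-- The total power received by the typical user from the interfering nodes of kind `j` in tier
`t`: the sum of `P h d ^ (-α)`. -/
noncomputable def received (p : Params) (S : Network Ω) (t : Fin 2) (j : Kind) (ω : Ω) : ℝ≥0∞ :=
  (S.inter t j).sumPoints
    (fun n ω x => kindPow p t j * ENNReal.ofReal (S.fading (some ((t, j), n)) ω) *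
      ‖x‖ₑ ^ (-p.α)) ω

/-- Downlink interference from tier `t` on channel 1 (the downlink channel). The interference from
full-duplex users is taken into account if `keep = true` and neglected if `keep = false`. -/
noncomputable def interference1 (p : Params) (S : Network Ω) (keep : Bool) (t : Fin 2) (ω : Ω) :
    ℝ≥0∞ :=
  S.received p t .bsFull ω + (if keep then S.received p t .userFull ω else 0)
    + S.received p t .bsHalf ω

/-- Downlink interference from tier `t` on channel 2 (the uplink channel). The interference from
full-duplex users is taken into account if `keep = true` and neglected if `keep = false`. -/
noncomputable def interference2 (p : Params) (S : Network Ω) (keep : Bool) (t : Fin 2) (ω : Ω) :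
    ℝ≥0∞ :=
  S.received p t .bsFull ω + (if keep then S.received p t .userFull ω else 0)
    + S.received p t .userHalf ω

/-- The power `P_k h D_k ^ (-α)` received from the tagged base station in tier `k`. -/
noncomputable def signal (p : Params) (S : Network Ω) (k : Fin 2) (ω : Ω) : ℝ≥0∞ :=
  p.pow k * ENNReal.ofReal (S.fading none ω) * S.dist k ω ^ (-p.α)

/-- Downlink SINR on channel 1 of a full-duplex typical user in tier `k`. -/
noncomputable def sinrFull1 (p : Params) (S : Network Ω) (keep : Bool) (k : Fin 2) (ω : Ω) :
    ℝ≥0∞ :=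
  S.signal p k ω / (p.rsiUser + ∑ t, S.interference1 p keep t ω + p.noise)

/-- Downlink SINR on channel 2 of a full-duplex typical user in tier `k`. -/
noncomputable def sinrFull2 (p : Params) (S : Network Ω) (keep : Bool) (k : Fin 2) (ω : Ω) :
    ℝ≥0∞ :=
  S.signal p k ω / (p.rsiUser + ∑ t, S.interference2 p keep t ω + p.noise)

/-- Downlink SINR (on channel 1) of a half-duplex typical user in tier `k`. -/
noncomputable def sinrHalf1 (p : Params) (S : Network Ω) (k : Fin 2) (ω : Ω) : ℝ≥0∞ :=
  S.signal p k ω / (∑ t, S.interference1 p true t ω + p.noise)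

/-- The distribution in tier `k` of the SINR `θ k` of a user in mode `m`: the conditional
probability that `θ k > T`, given that the typical user is in tier `k` and mode `m`. -/
noncomputable def tierDistribution (p : Params) (γ : Fin 2 → ℝ≥0∞) (S : Network Ω)
    (μ : Measure Ω) (m : Duplex) (θ : Fin 2 → Ω → ℝ≥0∞) (k : Fin 2) (T : ℝ≥0) : ℝ :=
  (cond μ (S.inMode p γ k m)).real {ω | (T : ℝ≥0∞) < θ k ω}

/-- The SINR distribution of a user in mode `m`: the average of the distributions in the two
tiers, weighted with the association probabilities. -/
noncomputable def distribution (p : Params) (γ : Fin 2 → ℝ≥0∞) (S : Network Ω)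
    (μ : Measure Ω) (m : Duplex) (θ : Fin 2 → Ω → ℝ≥0∞) (T : ℝ≥0) : ℝ :=
  (∑ k, μ.real (S.inMode p γ k m) * S.tierDistribution p γ μ m θ k T) /
    ∑ k, μ.real (S.inMode p γ k m)

end Network

end HetNet

namespace HetNet

/-! ### The function `exp (-x)` on `[0, ∞]` -/

/-! With thresholds `0` every user is full-duplex and the half-duplex intensities vanish. With
thresholds `∞` almost every user is half-duplex, because a Poisson process almost surely has its
nearest point at nonzero distance, and the full-duplex intensities vanish. Once the interference
from full-duplex users is dropped, only the base stations serving full-duplex users interfere in the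
first network, and only those serving half-duplex users in the second. These have the same transmit
power, the same exclusion radius and, at `δ = ∞` and `δ = 0` respectively, the same intensity
(`intensityMeasure_bsFull_eq_bsHalf`). The residual self-interference is zero, so it remains to see
that the SINR distribution depends on a network only through such data.

The two networks live on different probability spaces and a Poisson process is specified only
through its counts, so both distributions are computed. Given `D_k = r`, the SINR exceeds `T` iff
the fading `h_0` exceeds `s (σ² + I)`, where `s = T r ^ α / P_k`. As `h_0` is exponential and
independent of `I`, this has probability `E exp (-s (σ² + I))`, which factors into Laplace
functionals of the independent Poisson processes (`HasInterfererLaw.measure_lt_sinr`). It is then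
averaged over `D_k` given association with tier `k`, which involves only the joint law of the
distances; void probabilities and independence of the tiers determine that law
(`IsModel.distLaw_eq`). `IsModel.cond_lt_sinr_congr` combines these facts for `T > 0` and reaches `T
= 0` by a monotone limit. -/

@[simp] theorem expNeg_zero : expNeg 0 = 1 := by simp [expNeg]

@[simp] theorem expNeg_top : expNeg ∞ = 0 := by simp [expNeg]

theorem expNeg_antitone : Antitone expNeg := fun x y h => by
  unfold expNeg
  exact EReal.exp_monotone (EReal.neg_le_neg_iff.2 (EReal.coe_ennreal_le_coe_ennreal_iff.2 h))

theorem expNeg_le_one (x : ℝ≥0∞) : expNeg x ≤ 1 := by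
  simpa using expNeg_antitone (zero_le (a := x))

theorem expNeg_ne_top (x : ℝ≥0∞) : expNeg x ≠ ∞ :=
  ((expNeg_le_one x).trans_lt ENNReal.one_lt_top).ne

theorem continuous_expNeg : Continuous expNeg := by
  unfold expNeg
  exact ENNReal.continuous_exp.comp (continuous_neg.comp continuous_coe_ennreal_ereal)

@[fun_prop] theorem measurable_expNeg : Measurable expNeg := continuous_expNeg.measurable

theorem expNeg_ofReal {x : ℝ} (hx : 0 ≤ x) :
    expNeg (ENNReal.ofReal x) = ENNReal.ofReal (Real.exp (-x)) := by
  rw [expNeg, EReal.coe_ennreal_ofReal, max_eq_left hx, ← EReal.coe_neg, EReal.exp_coe]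

theorem expNeg_coe (x : ℝ≥0) : expNeg x = ENNReal.ofReal (Real.exp (-x)) := by
  rw [← expNeg_ofReal x.coe_nonneg, ENNReal.ofReal_coe_nnreal]

theorem expNeg_add (x y : ℝ≥0∞) : expNeg (x + y) = expNeg x * expNeg y := by
  induction x with
  | top => simp
  | coe x =>
    induction y with
    | top => simp
    | coe y =>
      rw [← ENNReal.coe_add, expNeg_coe, expNeg_coe, expNeg_coe, ← ENNReal.ofReal_mul
        (Real.exp_nonneg _), ← Real.exp_add]
      push_cast
      ring_nf

theorem expNeg_sum {ι : Type*} (s : Finset ι) (f : ι → ℝ≥0∞) :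
    expNeg (∑ i ∈ s, f i) = ∏ i ∈ s, expNeg (f i) := by
  classical
  induction s using Finset.induction_on with
  | empty => simp
  | insert i s hi ih => rw [Finset.sum_insert hi, Finset.prod_insert hi, expNeg_add, ih]

theorem expNeg_nsmul (n : ℕ) (x : ℝ≥0∞) : expNeg (n * x) = expNeg x ^ n := by
  simpa using expNeg_sum (Finset.range n) fun _ => x

/-- `-log y`, the inverse of `expNeg`. -/
noncomputable def negLog (y : ℝ≥0∞) : ℝ≥0∞ := (-ENNReal.log y).toENNReal

@[fun_prop] theorem measurable_negLog : Measurable negLog := by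
  unfold negLog
  exact ENNReal.measurable_log.neg.ereal_toENNReal

theorem expNeg_negLog {y : ℝ≥0∞} (hy : y ≤ 1) : expNeg (negLog y) = y := by
  have h : 0 ≤ -ENNReal.log y := by
    rw [← neg_zero, EReal.neg_le_neg_iff]
    exact ENNReal.log_le_zero_iff.2 hy
  rw [expNeg, negLog, EReal.coe_toENNReal h, neg_neg, ENNReal.exp_log]

/-! ### Laplace transform of a Poisson variable -/

/-- The exponential series at `q r`, with `q = exp (-c)`. The value `c = ∞` is included: since `∞ *
0 = 0`, it gives the probability of the value `0`, used later for void probabilities. -/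
theorem lintegral_expNeg_poissonMeasure (r : ℝ≥0) (c : ℝ≥0∞) :
    ∫⁻ n : ℕ, expNeg (c * n) ∂(poissonMeasure r) = expNeg ((1 - expNeg c) * r) := by
  obtain ⟨q, hq⟩ : ∃ q : ℝ≥0, expNeg c = q := ⟨_, (ENNReal.coe_toNNReal (expNeg_ne_top c)).symm⟩
  have hq1 : q ≤ 1 := by exact_mod_cast hq ▸ expNeg_le_one c
  have h1 : ∀ n : ℕ, expNeg (c * n) = ENNReal.ofReal ((q : ℝ) ^ n) := fun n => by
    rw [mul_comm, expNeg_nsmul, hq, ENNReal.ofReal_pow q.coe_nonneg, ENNReal.ofReal_coe_nnreal]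
  rw [lintegral_countable']
  simp_rw [h1, poissonMeasure_singleton]
  have h2 : ∀ n : ℕ, ENNReal.ofReal ((q : ℝ) ^ n) *
      ENNReal.ofReal (Real.exp (-r) * r ^ n / (n.factorial : ℝ)) =
      ENNReal.ofReal (Real.exp (-r) * ((q * r : ℝ) ^ n / (n.factorial : ℝ))) := fun n => by
    rw [← ENNReal.ofReal_mul (by positivity)]
    congr 1
    rw [mul_pow]
    ring
  have h3 : HasSum (fun n : ℕ => Real.exp (-r) * ((q * r : ℝ) ^ n / (n.factorial : ℝ)))
      (Real.exp (-r) * Real.exp (q * r)) := by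
    have := NormedSpace.expSeries_div_hasSum_exp (q * r : ℝ)
    rw [← Real.exp_eq_exp_ℝ] at this
    exact this.mul_left _
  simp_rw [h2]
  rw [← ENNReal.ofReal_tsum_of_nonneg (fun n => by positivity) h3.summable, h3.tsum_eq, hq,
    ← Real.exp_add]
  have : (1 - (q : ℝ≥0∞)) * r = (((1 - q) * r : ℝ≥0) : ℝ≥0∞) := by push_cast; rfl
  rw [this, expNeg_coe]
  congr 2
  push_cast [NNReal.coe_sub hq1]
  ring

/-! ### Point processes -/

namespace PointProcess

variable {Ω : Type*} [MeasurableSpace Ω]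

theorem measurableSet_lt_count (X : PointProcess Ω) (n : ℕ) :
    MeasurableSet {ω | (n : ℕ∞) < X.count ω} :=
  X.measurable_count (MeasurableSet.of_discrete (s := Set.Ioi (n : ℕ∞)))

@[fun_prop] theorem measurable_config (X : PointProcess Ω) : Measurable X.config :=
  X.measurable_count.prodMk (measurable_pi_lambda _ X.measurable_pt)

open Classical in
theorem measurable_sumPoints (X : PointProcess Ω) {f : ℕ → Ω → Plane → ℝ≥0∞}
    (hf : ∀ n, Measurable fun q : Ω × Plane => f n q.1 q.2) : Measurable (X.sumPoints f) := by
  unfold sumPoints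
  refine Measurable.tsum fun n => Measurable.ite (X.measurableSet_lt_count n) ?_
    measurable_const
  exact (hf n).comp (measurable_id.prodMk (X.measurable_pt n))

theorem measurable_numIn (X : PointProcess Ω) {B : Set Plane} (hB : MeasurableSet B) :
    Measurable (X.numIn B) :=
  X.measurable_sumPoints fun _ => (measurable_one.indicator hB).comp measurable_snd

theorem sumPoints_sum {ι : Type*} (X : PointProcess Ω) (s : Finset ι)
    (c : ι → ℝ≥0∞) (f : ι → Plane → ℝ≥0∞) (ω : Ω) :
    X.sumPoints (fun _ _ x => ∑ i ∈ s, c i * f i x) ω =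
      ∑ i ∈ s, c i * X.sumPoints (fun _ _ x => f i x) ω := by
  unfold sumPoints
  simp_rw [← ENNReal.tsum_mul_left]
  rw [← Summable.tsum_finsetSum fun _ _ => ENNReal.summable]
  refine tsum_congr fun n => ?_
  split_ifs <;> simp

theorem numIn_eq_zero_iff (X : PointProcess Ω) (B : Set Plane) (ω : Ω) :
    X.numIn B ω = 0 ↔ ∀ n : ℕ, (n : ℕ∞) < X.count ω → X.pt n ω ∉ B := by
  simp only [numIn, sumPoints, ENNReal.tsum_eq_zero, ite_eq_right_iff, Set.indicator_apply_eq_zero,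
    Pi.one_apply, one_ne_zero, imp_false]

theorem sumPoints_iSup (X : PointProcess Ω) {f : ℕ → Plane → ℝ≥0∞} (hf : Monotone f) (ω : Ω) :
    X.sumPoints (fun _ _ x => ⨆ m, f m x) ω = ⨆ m, X.sumPoints (fun _ _ x => f m x) ω := by
  unfold sumPoints
  rw [ENNReal.tsum_eq_iSup_sum]
  simp_rw [ENNReal.tsum_eq_iSup_sum]
  rw [iSup_comm]
  refine iSup_congr fun s => ?_
  rw [← ENNReal.finsetSum_iSup_of_monotone
    (f := fun (n : ℕ) m => if (n : ℕ∞) < X.count ω then f m (X.pt n ω) else 0)]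
  · refine Finset.sum_congr rfl fun n _ => ?_
    split_ifs <;> simp
  · intro n a b h
    dsimp only
    split_ifs
    exacts [hf h _, le_rfl]

namespace IsPoisson

variable {X : PointProcess Ω} {Λ : Measure Plane} {μ : Measure Ω}

theorem lintegral_expNeg_numIn (hX : X.IsPoisson Λ μ) {B : Set Plane} (hB : MeasurableSet B)
    (hΛ : Λ B ≠ ∞) (c : ℝ≥0∞) :
    ∫⁻ ω, expNeg (c * X.numIn B ω) ∂μ = expNeg ((1 - expNeg c) * Λ B) := by
  have h : Measurable fun x : ℝ≥0∞ => expNeg (c * x) := by fun_prop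
  rw [← lintegral_map h (X.measurable_numIn hB), hX.law_numIn B hB hΛ,
    lintegral_map h (measurable_of_countable _), lintegral_expNeg_poissonMeasure,
    ENNReal.coe_toNNReal hΛ]

theorem lintegral_expNeg_sum_numIn (hX : X.IsPoisson Λ μ) {ι : Type*} [Fintype ι]
    {B : ι → Set Plane} (hB : ∀ i, MeasurableSet (B i))
    (hd : Pairwise fun i j => Disjoint (B i) (B j)) (hΛ : ∀ i, Λ (B i) ≠ ∞) (c : ι → ℝ≥0∞) :
    ∫⁻ ω, expNeg (∑ i, c i * X.numIn (B i) ω) ∂μ =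
      expNeg (∑ i, (1 - expNeg (c i)) * Λ (B i)) := by
  let e := Fintype.equivFin ι
  have hi : iIndepFun (fun i => X.numIn (B i)) μ := by
    have := hX.indep_numIn (Fintype.card ι) (fun i => B (e.symm i)) (fun i => hB _)
      fun i j h => hd (e.symm.injective.ne h)
    have := this.precomp e.injective
    simpa using this
  simp_rw [expNeg_sum]
  refine (lintegral_prod_eq_prod_lintegral_of_indepFun _ _
    (hi.comp (fun i x => expNeg (c i * x)) fun i => by fun_prop) fun i =>
      (show Measurable fun x : ℝ≥0∞ => expNeg (c i * x) by fun_prop).comp (X.measurable_numIn (hB i))).trans ?_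
  exact Finset.prod_congr rfl fun i _ => hX.lintegral_expNeg_numIn (hB i) (hΛ i) _

/-- The Laplace functional of a Poisson process at a simple function of finite support. -/
theorem lintegral_expNeg_sumPoints_simpleFunc (hX : X.IsPoisson Λ μ) (g : SimpleFunc Plane ℝ≥0∞)
    {S : Set Plane} (hS : MeasurableSet S) (hΛ : Λ S ≠ ∞) :
    ∫⁻ ω, expNeg (X.sumPoints (fun _ _ x => S.indicator g x) ω) ∂μ =
      expNeg (∫⁻ x, (1 - expNeg (S.indicator g x)) ∂Λ) := by
  classical
  let B : g.range → Set Plane := fun c => g ⁻¹' {(c : ℝ≥0∞)} ∩ S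
  have hB : ∀ i, MeasurableSet (B i) := fun i => (g.measurableSet_preimage _).inter hS
  -- Used twice: with the identity to write the sum over points through counts, and with `1 -
  -- expNeg` to evaluate the integral on the right. `F 0 = 0` takes care of the points outside `S`.
  have hg : ∀ (F : ℝ≥0∞ → ℝ≥0∞), F 0 = 0 → ∀ x, F (S.indicator g x) =
      ∑ c : g.range, F c * (B c).indicator 1 x := by
    intro F hF x
    rw [Finset.sum_eq_single (⟨g x, g.mem_range_self x⟩ : g.range)]
    · by_cases hx : x ∈ S <;> simp [B, hx, hF]
    · rintro ⟨c, hc⟩ - h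
      have : g x ≠ c := fun h' => h (Subtype.ext h'.symm)
      simp [B, this]
    · simp
  have hd : Pairwise fun i j => Disjoint (B i) (B j) := by
    intro i j hij
    refine Set.disjoint_left.2 fun x hx hx' => hij (Subtype.ext ?_)
    exact hx.1.symm.trans hx'.1
  have h1 : ∀ ω, X.sumPoints (fun _ _ x => S.indicator g x) ω =
      ∑ c : g.range, (c : ℝ≥0∞) * X.numIn (B c) ω := fun ω => by
    simp_rw [hg (fun c => c) rfl]
    exact X.sumPoints_sum _ _ _ ω
  simp_rw [h1]
  rw [hX.lintegral_expNeg_sum_numIn hB hd fun i => measure_ne_top_of_subset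
    Set.inter_subset_right hΛ]
  simp_rw [hg (fun c => 1 - expNeg c) (by simp)]
  rw [lintegral_finsetSum _ fun i _ => (measurable_one.indicator (hB i)).const_mul _]
  congr 1
  refine Finset.sum_congr rfl fun i _ => ?_
  rw [lintegral_const_mul _ (measurable_one.indicator (hB i)), lintegral_indicator_one (hB i)]

/-- The Laplace functional of a Poisson process. -/
theorem lintegral_expNeg_sumPoints [IsFiniteMeasure μ] [SigmaFinite Λ] (hX : X.IsPoisson Λ μ)
    {f : Plane → ℝ≥0∞} (hf : Measurable f) :
    ∫⁻ ω, expNeg (X.sumPoints (fun _ _ x => f x) ω) ∂μ =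
      expNeg (∫⁻ x, (1 - expNeg (f x)) ∂Λ) := by
  let S := spanningSets Λ
  -- Cutting off to sets of finite intensity is necessary because `IsPoisson` prescribes the law of
  -- a count only on such sets.
  let g : ℕ → Plane → ℝ≥0∞ := fun m => (S m).indicator (SimpleFunc.eapprox f m)
  have hgm : ∀ m, Measurable (g m) := fun m =>
    (SimpleFunc.measurable _).indicator (measurableSet_spanningSets Λ m)
  have hmono : Monotone g := by
    intro a b hab x
    refine (Set.indicator_le_indicator (SimpleFunc.monotone_eapprox f hab x)).trans ?_
    exact Set.indicator_le_indicator_of_subset (monotone_spanningSets Λ hab) (by simp) x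
  have hsup : ∀ x, ⨆ m, g m x = f x := by
    intro x
    refine le_antisymm (iSup_le fun m => ?_) ?_
    · refine (Set.indicator_le_self' (fun _ _ => zero_le) x).trans ?_
      rw [← SimpleFunc.iSup_eapprox_apply hf x]
      exact le_iSup (fun m => SimpleFunc.eapprox f m x) m
    · rw [← SimpleFunc.iSup_eapprox_apply hf x]
      refine iSup_le fun m => ?_
      have hx := mem_spanningSetsIndex Λ x
      refine le_iSup_of_le (max m (spanningSetsIndex Λ x)) ?_
      have : x ∈ S (max m (spanningSetsIndex Λ x)) :=
        monotone_spanningSets Λ (le_max_right _ _) hx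
      simp only [g, Set.indicator_of_mem this]
      exact SimpleFunc.monotone_eapprox f (le_max_left _ _) x
  have key : ∀ m, ∫⁻ ω, expNeg (X.sumPoints (fun _ _ x => g m x) ω) ∂μ =
      expNeg (∫⁻ x, (1 - expNeg (g m x)) ∂Λ) := fun m =>
    hX.lintegral_expNeg_sumPoints_simpleFunc _ (measurableSet_spanningSets Λ m)
      (measure_spanningSets_lt_top Λ m).ne
  have hl : Filter.Tendsto (fun m => ∫⁻ ω, expNeg (X.sumPoints (fun _ _ x => g m x) ω) ∂μ)
      Filter.atTop (nhds (∫⁻ ω, expNeg (X.sumPoints (fun _ _ x => f x) ω) ∂μ)) := by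
    refine tendsto_lintegral_of_dominated_convergence (fun _ => 1) (fun m => ?_)
      (fun m => .of_forall fun ω => expNeg_le_one _) (by simp) (.of_forall fun ω => ?_)
    · exact measurable_expNeg.comp (X.measurable_sumPoints fun _ => (hgm m).comp measurable_snd)
    · refine (continuous_expNeg.tendsto _).comp ?_
      simp_rw [← hsup]
      rw [X.sumPoints_iSup hmono]
      refine tendsto_atTop_iSup fun a b hab => ?_
      refine ENNReal.tsum_le_tsum fun n => ?_
      split_ifs
      exacts [hmono hab _, le_rfl]
  have hr : Filter.Tendsto (fun m => expNeg (∫⁻ x, (1 - expNeg (g m x)) ∂Λ))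
      Filter.atTop (nhds (expNeg (∫⁻ x, (1 - expNeg (f x)) ∂Λ))) := by
    refine (continuous_expNeg.tendsto _).comp ?_
    refine lintegral_tendsto_of_tendsto_of_monotone
      (fun m => (measurable_const.sub (measurable_expNeg.comp (hgm m))).aemeasurable)
      (.of_forall fun x a b hab => tsub_le_tsub_left (expNeg_antitone (hmono hab x)) 1)
      (.of_forall fun x => ?_)
    refine ENNReal.Tendsto.sub tendsto_const_nhds ((continuous_expNeg.tendsto _).comp ?_)
      (Or.inl ENNReal.one_ne_top)
    rw [← hsup]
    exact tendsto_atTop_iSup fun a b hab => hmono hab x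
  simp_rw [key] at hl
  exact tendsto_nhds_unique hl hr

end IsPoisson

end PointProcess

/-! ### Exponential fading -/

instance : IsProbabilityMeasure (expMeasure 1) := isProbabilityMeasure_expMeasure one_pos

theorem expMeasure_lt_ofReal (u : ℝ≥0∞) :
    expMeasure 1 {h | u < ENNReal.ofReal h} = expNeg u := by
  induction u with
  | top => simp
  | coe x =>
    have h1 : {h : ℝ | (x : ℝ≥0∞) < ENNReal.ofReal h} = (Set.Iic (x : ℝ))ᶜ := by
      ext h
      rw [Set.mem_ofPred_eq, ← ENNReal.ofReal_coe_nnreal,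
        ENNReal.ofReal_lt_ofReal_iff_of_nonneg x.coe_nonneg]
      simp
    rw [h1, prob_compl_eq_one_sub measurableSet_Iic, ← ofReal_cdf, cdf_expMeasure_eq one_pos,
      if_pos x.coe_nonneg, ← ENNReal.ofReal_one, ← ENNReal.ofReal_sub _ (by simp), expNeg_coe]
    simp

/-- The Laplace transform of an exponential variable of mean one. -/
noncomputable def fadingLaplace (a : ℝ≥0∞) : ℝ≥0∞ :=
  ∫⁻ h, expNeg (a * ENNReal.ofReal h) ∂(expMeasure 1)

theorem fadingLaplace_le_one (a : ℝ≥0∞) : fadingLaplace a ≤ 1 :=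
  (lintegral_mono fun _ => expNeg_le_one _).trans (by simp)

@[simp] theorem fadingLaplace_zero : fadingLaplace 0 = 1 := by simp [fadingLaplace]

@[fun_prop] theorem measurable_fadingLaplace : Measurable fadingLaplace := by
  unfold fadingLaplace
  exact Measurable.lintegral_prod_right' (f := fun q : ℝ≥0∞ × ℝ =>
    expNeg (q.1 * ENNReal.ofReal q.2)) (by fun_prop)

/-- `-log` of the Laplace transform of an exponential variable of mean one. -/
noncomputable def fadingExponent (a : ℝ≥0∞) : ℝ≥0∞ := negLog (fadingLaplace a)

@[fun_prop] theorem measurable_fadingExponent : Measurable fadingExponent := by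
  unfold fadingExponent
  fun_prop

@[simp] theorem fadingExponent_zero : fadingExponent 0 = 0 := by
  simp [fadingExponent, negLog]

theorem expNeg_fadingExponent (a : ℝ≥0∞) : expNeg (fadingExponent a) = fadingLaplace a :=
  expNeg_negLog (fadingLaplace_le_one a)

theorem measurable_add_tsum_fading {Ω ι : Type*} [Countable ι] {m : MeasurableSpace Ω} {H : ι → Ω → ℝ}
    (hH : ∀ i, Measurable (H i)) (a : ι → ℝ≥0∞) (b : ℝ≥0∞) :
    Measurable fun ω => b + ∑' i, a i * ENNReal.ofReal (H i ω) :=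
  Measurable.const_add (Measurable.tsum fun i => by fun_prop) b

section Fading

variable {Ω ι : Type*} [MeasurableSpace Ω] {ν : Measure Ω}

/-- Independence gives the formula for finite partial sums, and dominated convergence along the
finite subsets gives it for the whole sum. Writing each Laplace transform as `expNeg` of
`fadingExponent` replaces an infinite product by a sum, which later becomes a sum over the points of
a Poisson process. -/
theorem lintegral_expNeg_tsum_fading [Countable ι] {H : ι → Ω → ℝ}
    (hm : ∀ i, Measurable (H i)) (hi : iIndepFun H ν) (hl : ∀ i, ν.map (H i) = expMeasure 1)
    (a : ι → ℝ≥0∞) :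
    ∫⁻ ω, expNeg (∑' i, a i * ENNReal.ofReal (H i ω)) ∂ν =
      expNeg (∑' i, fadingExponent (a i)) := by
  have := hi.isProbabilityMeasure
  have hfin : ∀ s : Finset ι, ∫⁻ ω, expNeg (∑ i ∈ s, a i * ENNReal.ofReal (H i ω)) ∂ν =
      expNeg (∑ i ∈ s, fadingExponent (a i)) := by
    intro s
    simp_rw [expNeg_sum, expNeg_fadingExponent]
    refine (lintegral_prod_eq_prod_lintegral_of_indepFun s _
      (hi.comp (fun i x => expNeg (a i * ENNReal.ofReal x)) fun i => by fun_prop)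
      fun i => (show Measurable fun x : ℝ => expNeg (a i * ENNReal.ofReal x) by fun_prop).comp
        (hm i)).trans ?_
    refine Finset.prod_congr rfl fun i _ => ?_
    rw [fadingLaplace, ← hl i, lintegral_map (by fun_prop) (hm i)]
    rfl
  have hL : Filter.Tendsto
      (fun s : Finset ι => ∫⁻ ω, expNeg (∑ i ∈ s, a i * ENNReal.ofReal (H i ω)) ∂ν)
      Filter.atTop (nhds (∫⁻ ω, expNeg (∑' i, a i * ENNReal.ofReal (H i ω)) ∂ν)) := by
    refine tendsto_lintegral_filter_of_dominated_convergence (fun _ => 1)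
      (.of_forall fun s => by fun_prop) (.of_forall fun s => .of_forall fun ω => expNeg_le_one _)
      (by simp) (.of_forall fun ω => ?_)
    exact (continuous_expNeg.tendsto _).comp ENNReal.summable.hasSum
  have hR : Filter.Tendsto (fun s : Finset ι => expNeg (∑ i ∈ s, fadingExponent (a i)))
      Filter.atTop (nhds (expNeg (∑' i, fadingExponent (a i)))) :=
    (continuous_expNeg.tendsto _).comp ENNReal.summable.hasSum
  simp_rw [hfin] at hL
  exact tendsto_nhds_unique hL hR

/-- Fubini applied to the tail `exp (-u)` of the exponential law, with `u` the frozen value of `Z`.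
-/
theorem measure_lt_ofReal_of_indepFun [IsFiniteMeasure ν] {Z : Ω → ℝ≥0∞} {h : Ω → ℝ}
    (hZ : Measurable Z) (hh : Measurable h) (hi : IndepFun Z h ν) (hl : ν.map h = expMeasure 1) :
    ν {ω | Z ω < ENNReal.ofReal (h ω)} = ∫⁻ ω, expNeg (Z ω) ∂ν := by
  have hE : MeasurableSet {q : ℝ≥0∞ × ℝ | q.1 < ENNReal.ofReal q.2} :=
    measurableSet_lt (by fun_prop) (by fun_prop)
  have h1 : ν {ω | Z ω < ENNReal.ofReal (h ω)} =
      ν.map (fun ω => (Z ω, h ω)) {q : ℝ≥0∞ × ℝ | q.1 < ENNReal.ofReal q.2} := by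
    rw [Measure.map_apply (hZ.prodMk hh) hE]
    rfl
  rw [h1, hi.map_prod_eq_prod_map_map hZ.aemeasurable hh.aemeasurable, hl, Measure.prod_apply hE,
    ← lintegral_map measurable_expNeg hZ]
  exact lintegral_congr fun z => expMeasure_lt_ofReal z

/-- The probability that an exponential signal exceeds a threshold plus an independently faded
countable sum. -/
theorem measure_add_tsum_lt_fading [Countable ι] {H : Option ι → Ω → ℝ}
    (hm : ∀ i, Measurable (H i)) (hi : iIndepFun H ν) (hl : ∀ i, ν.map (H i) = expMeasure 1)
    (a : ι → ℝ≥0∞) (b : ℝ≥0∞) :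
    ν {ω | b + ∑' i, a i * ENNReal.ofReal (H (some i) ω) < ENNReal.ofReal (H none ω)} =
      expNeg b * expNeg (∑' i, fadingExponent (a i)) := by
  have := hi.isProbabilityMeasure
  have hsum := measurable_add_tsum_fading (fun i => hm (some i)) a
  have hexp : Measurable fun ω => expNeg (∑' i, a i * ENNReal.ofReal (H (some i) ω)) := by
    simpa [Function.comp_def] using measurable_expNeg.comp (hsum 0)
  rw [measure_lt_ofReal_of_indepFun (hsum b) (hm none) ?_ (hl none)]
  · simp_rw [expNeg_add]
    rw [lintegral_const_mul _ hexp, lintegral_expNeg_tsum_fading (fun i => hm (some i))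
        (hi.precomp (Option.some_injective ι)) (fun i => hl (some i))]
  -- The countable sum is measurable for the σ-algebra generated by the `some` coordinates, which is
  -- independent of that of `none`.
  · have hind := indep_iSup_of_disjoint (fun i => (hm i).comap_le) hi.iIndep
      (S := Set.range some) (T := {none}) (by simp)
    rw [IndepFun_iff_Indep]
    refine indep_of_indep_of_le_left (indep_of_indep_of_le_right hind ?_) ?_
    · exact le_iSup₂_of_le none rfl le_rfl
    · refine Measurable.comap_le (measurable_add_tsum_fading (fun i => ?_) a b)
      exact (comap_measurable (H (some i))).mono (le_iSup₂_of_le (some i) ⟨i, rfl⟩ le_rfl) le_rfl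

end Fading

/-! ### The interference given the distance from the tagged base station -/

instance : Finite Kind :=
  Finite.of_surjective (fun i : Fin 4 => ![Kind.bsFull, .bsHalf, .userFull, .userHalf] i) fun j => by
    cases j
    exacts [⟨0, rfl⟩, ⟨1, rfl⟩, ⟨2, rfl⟩, ⟨3, rfl⟩]

namespace Network

variable {Ω : Type*} [MeasurableSpace Ω]

theorem measurable_received (p : Params) (S : Network Ω) (t : Fin 2) (j : Kind) :
    Measurable (S.received p t j) := by
  refine (S.inter t j).measurable_sumPoints fun n => ?_
  have := S.measurable_fading (some ((t, j), n))
  fun_prop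

/-- `-log` of the Laplace transform at `s` of the power received from a node of kind `j` in
tier `t` at position `x`. -/
noncomputable def pathExponent (p : Params) (i : Fin 2 × Kind) (s : ℝ≥0∞) (x : Plane) : ℝ≥0∞ :=
  fadingExponent (s * kindPow p i.1 i.2 * ‖x‖ₑ ^ (-p.α))

@[fun_prop] theorem measurable_pathExponent (p : Params) (i : Fin 2 × Kind) :
    Measurable fun q : ℝ≥0∞ × Plane => pathExponent p i q.1 q.2 := by
  unfold pathExponent
  fun_prop

open Classical in
theorem measurable_expNeg_configSum {f : Plane → ℝ≥0∞} (hf : Measurable f) :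
    Measurable fun c : ℕ∞ × (ℕ → Plane) =>
      expNeg (∑' n : ℕ, if (n : ℕ∞) < c.1 then f (c.2 n) else 0) := by
  refine measurable_expNeg.comp (Measurable.tsum fun n => Measurable.ite ?_ ?_ measurable_const)
  · exact measurable_fst (MeasurableSet.of_discrete (s := Set.Ioi (n : ℕ∞)))
  · exact hf.comp (by fun_prop)

open Classical in
-- With the positions frozen, the interference is a countable sum of independent exponentials with
-- fixed weights. Averaging over the fading first turns each faded sum into a sum of `pathExponent`
-- over the points, and independence of the processes then splits the expectation. The Poisson
-- property is not yet needed.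
theorem HasInterfererLaw.measure_add_sum_received_lt {p : Params} {γ : Fin 2 → ℝ≥0∞}
    {S : Network Ω} {μ : Measure Ω} {k : Fin 2} {r : ℝ≥0∞} {ν : Measure Ω}
    (h : S.HasInterfererLaw p γ μ k r ν) (J : Finset (Fin 2 × Kind)) (s b : ℝ≥0∞) :
    ν {ω | b + s * ∑ i ∈ J, S.received p i.1 i.2 ω < ENNReal.ofReal (S.fading none ω)} =
      expNeg b * ∏ i ∈ J, ∫⁻ ω, expNeg ((S.inter i.1 i.2).sumPoints
        (fun _ _ x => pathExponent p i s x) ω) ∂ν := by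
  have := h.indep_fading.isProbabilityMeasure
  -- Weight zero beyond the number of points makes the interference a sum over the fixed index set
  -- `J × ℕ`, with weights that depend on the configuration alone.
  let w : (Fin 2 × Kind → ℕ∞ × (ℕ → Plane)) → J × ℕ → ℝ≥0∞ := fun c q =>
    if (q.2 : ℕ∞) < (c q.1).1 then s * kindPow p q.1.1.1 q.1.1.2 * ‖(c q.1).2 q.2‖ₑ ^ (-p.α) else 0
  have hw : ∀ q, Measurable fun c => w c q := fun q => by
    refine Measurable.ite ?_ (by fun_prop) measurable_const
    exact (measurable_fst.comp (measurable_pi_apply _))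
      (MeasurableSet.of_discrete (s := Set.Ioi (q.2 : ℕ∞)))
  let C : Ω → Fin 2 × Kind → ℕ∞ × (ℕ → Plane) := fun ω i => (S.inter i.1 i.2).config ω
  let H : Ω → Option ((Fin 2 × Kind) × ℕ) → ℝ := fun ω i => S.fading i ω
  have hC : Measurable C := measurable_pi_lambda _ fun i => (S.inter i.1 i.2).measurable_config
  have hH : Measurable H := measurable_pi_lambda _ S.measurable_fading
  let E : Set ((Fin 2 × Kind → ℕ∞ × (ℕ → Plane)) × (Option ((Fin 2 × Kind) × ℕ) → ℝ)) :=
    {e | b + ∑' q : J × ℕ, w e.1 q * ENNReal.ofReal (e.2 (some (q.1, q.2))) <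
      ENNReal.ofReal (e.2 none)}
  have hE : MeasurableSet E := by
    refine measurableSet_lt (Measurable.const_add (Measurable.tsum fun q => ?_) b) (by fun_prop)
    exact ((hw q).comp measurable_fst).mul (by fun_prop)
  have hrec : ∀ ω, s * ∑ i ∈ J, S.received p i.1 i.2 ω =
      ∑' q : J × ℕ, w (C ω) q * ENNReal.ofReal (H ω (some (q.1, q.2))) := fun ω => by
    rw [ENNReal.tsum_prod (f := fun (i : J) (n : ℕ) =>
      w (C ω) (i, n) * ENNReal.ofReal (H ω (some (i, n)))), tsum_fintype, Finset.mul_sum,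
      ← Finset.sum_coe_sort]
    refine Finset.sum_congr rfl fun i _ => ?_
    rw [received, PointProcess.sumPoints, ← ENNReal.tsum_mul_left]
    refine tsum_congr fun n => ?_
    simp only [w, C, H, PointProcess.config, mul_ite, mul_zero, ite_mul, zero_mul]
    congr 1
    ring
  have h1 : {ω | b + s * ∑ i ∈ J, S.received p i.1 i.2 ω < ENNReal.ofReal (S.fading none ω)} =
      (fun ω => (C ω, H ω)) ⁻¹' E := by
    ext ω
    simp only [Set.mem_ofPred_eq, hrec, E, Set.mem_preimage]
    rfl
  have h2 : ∀ c, ν.map H (Prod.mk c ⁻¹' E) =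
      expNeg b * expNeg (∑' q : J × ℕ, fadingExponent (w c q)) := fun c => by
    rw [Measure.map_apply hH (measurable_prodMk_left hE)]
    refine measure_add_tsum_lt_fading (H := fun o : Option (J × ℕ) =>
      S.fading (o.map fun q => ((q.1 : Fin 2 × Kind), q.2))) (fun i => S.measurable_fading _)
      (h.indep_fading.precomp (Option.map_injective ?_)) (fun i => h.law_fading _) (w c) b
    rintro ⟨i, n⟩ ⟨j, m⟩ hij
    exact Prod.ext (Subtype.ext (Prod.ext_iff.1 hij).1) (Prod.ext_iff.1 hij).2
  have hm : Measurable fun c => expNeg (∑' q : J × ℕ, fadingExponent (w c q)) :=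
    measurable_expNeg.comp (Measurable.tsum fun q => measurable_fadingExponent.comp (hw q))
  -- Configurations and fading are independent, so their joint law is a product and the inner
  -- integral over the fading is `h2`.
  rw [h1, ← Measure.map_apply (hC.prodMk hH) hE,
    h.indep_inter_fading.map_prod_eq_prod_map_map hC.aemeasurable hH.aemeasurable,
    Measure.prod_apply hE]
  simp_rw [h2]
  rw [lintegral_const_mul _ hm, lintegral_map hm hC]
  congr 1
  refine Eq.trans ?_ (lintegral_prod_eq_prod_lintegral_of_indepFun J _
    (h.indep_inter.comp _ fun i => measurable_expNeg_configSum
      (f := fun x => pathExponent p i s x) (by fun_prop))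
    fun i => (measurable_expNeg_configSum (by fun_prop)).comp
      (S.inter i.1 i.2).measurable_config)
  refine lintegral_congr fun ω => ?_
  rw [ENNReal.tsum_prod (f := fun (i : J) (n : ℕ) => fadingExponent (w (C ω) (i, n))),
    tsum_fintype, expNeg_sum]
  refine Eq.trans ?_ (Finset.prod_coe_sort J _)
  refine Finset.prod_congr rfl fun i _ => congrArg expNeg (tsum_congr fun n => ?_)
  simp only [w, C, PointProcess.config, pathExponent, apply_ite fadingExponent,
    fadingExponent_zero]

end Network

/-! ### Disintegration along a random variable -/

/-- Under the conditional law given `D`, the value of `D` may be frozen. The set of pairs `(ω, ω')`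
with `(D ω, ω') ∈ A` is measurable for the product of the σ-algebra of `D` with the full one, and
there the trimmed measure composed with the kernel is the image of `μ` under the diagonal. -/
theorem measure_eq_lintegral_condExpKernel {Ω β : Type*} [mΩ : MeasurableSpace Ω]
    [StandardBorelSpace Ω] [mβ : MeasurableSpace β] (μ : Measure Ω) [IsFiniteMeasure μ] {D : Ω → β}
    (hD : Measurable D) {A : Set (β × Ω)} (hA : MeasurableSet A) :
    μ {ω | (D ω, ω) ∈ A} =
      ∫⁻ ω, condExpKernel μ (MeasurableSpace.comap D inferInstance) ω {ω' | (D ω, ω') ∈ A} ∂μ := by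
  have hm : MeasurableSpace.comap D mβ ≤ mΩ := hD.comap_le
  have hA' : MeasurableSet[(MeasurableSpace.comap D mβ).prod mΩ] {q : Ω × Ω | (D q.1, q.2) ∈ A} := by
    have h1 : @Measurable (Ω × Ω) β ((MeasurableSpace.comap D mβ).prod mΩ) _ fun q => D q.1 :=
      @Measurable.comp _ _ _ ((MeasurableSpace.comap D mβ).prod mΩ) (MeasurableSpace.comap D mβ) _
        _ _ (comap_measurable D) (@measurable_fst _ _ (MeasurableSpace.comap D mβ) mΩ)
    have h2 : @Measurable (Ω × Ω) Ω ((MeasurableSpace.comap D mβ).prod mΩ) _ fun q => q.2 :=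
      @measurable_snd _ _ (MeasurableSpace.comap D mβ) mΩ
    exact (h1.prodMk h2) hA
  have hdiag : @Measurable Ω (Ω × Ω) mΩ ((MeasurableSpace.comap D mβ).prod mΩ) Function.diag :=
    @Measurable.prodMk _ mΩ _ _ (MeasurableSpace.comap D mβ) mΩ _ _
      (measurable_id'' hm) (@measurable_id _ mΩ)
  have h := congrArg (fun ρ => ρ {q : Ω × Ω | (D q.1, q.2) ∈ A})
    (compProd_trim_condExpKernel (μ := μ) hm)
  beta_reduce at h
  rw [@Measure.compProd_apply _ _ (MeasurableSpace.comap D mβ) mΩ _ _ _ _ _ hA',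
    @Measure.map_apply _ _ mΩ ((MeasurableSpace.comap D mβ).prod mΩ) _ _ hdiag _ hA',
    lintegral_trim hm (@Kernel.measurable_kernel_prodMk_left _ _ (MeasurableSpace.comap D mβ) mΩ
      (condExpKernel μ (MeasurableSpace.comap D mβ)) _ _ hA')] at h
  exact h.symm

namespace Network

variable {Ω : Type*} [MeasurableSpace Ω]

/-! ### Intensities of the interferers -/

theorem modeDens_ne_top (p : Params) (γ : Fin 2 → ℝ≥0∞) (S : Network Ω) (μ : Measure Ω)
    (t : Fin 2) (m : Duplex) : S.modeDens p γ μ t m ≠ ∞ := by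
  have h : S.inMode p γ t m ⊆ S.inTier p t := by
    cases m <;> exact fun ω h => h.1
  refine ENNReal.mul_ne_top (ne_top_of_le_ne_top ENNReal.one_ne_top ?_) ENNReal.coe_ne_top
  exact ENNReal.div_le_of_le_mul (by simpa using measure_mono h)

theorem intensity_ne_top (p : Params) (γ : Fin 2 → ℝ≥0∞) (S : Network Ω) (μ : Measure Ω)
    (k t : Fin 2) (r : ℝ≥0∞) (j : Kind) (y : ℝ≥0∞) : S.intensity p γ μ k t r j y ≠ ∞ := by
  have h : ∀ m x, S.modeDens p γ μ t m * (1 - x) ≠ ∞ := fun m x =>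
    ENNReal.mul_ne_top (modeDens_ne_top p γ S μ t m) (ENNReal.sub_ne_top ENNReal.one_ne_top)
  cases j
  · exact h _ _
  · simp only [intensity]
    split_ifs
    exacts [ENNReal.zero_ne_top, h _ _]
  · exact h _ _
  · exact h _ _

/-- The intensity is finite at every point, since a mode density is at most the density of its tier;
the Laplace functional requires σ-finiteness. -/
instance (p : Params) (γ : Fin 2 → ℝ≥0∞) (S : Network Ω) (μ : Measure Ω)
    (k t : Fin 2) (r : ℝ≥0∞) (j : Kind) : SigmaFinite (S.intensityMeasure p γ μ k t r j) := by
  refine SigmaFinite.withDensity_of_ne_top' fun x => ?_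
  split_ifs
  exacts [intensity_ne_top p γ S μ k t r j _, ENNReal.zero_ne_top]

theorem measurable_intensity (p : Params) (γ : Fin 2 → ℝ≥0∞) (S : Network Ω) (μ : Measure Ω)
    (k t : Fin 2) (j : Kind) :
    Measurable fun q : ℝ≥0∞ × ℝ≥0∞ => S.intensity p γ μ k t q.1 j q.2 := by
  have h : Measurable fun q : ℝ≥0∞ × ℝ≥0∞ => p.handover k t q.1 q.2 := by
    unfold Params.handover
    fun_prop
  cases j <;> unfold intensity
  · fun_prop
  · refine Measurable.ite (measurableSet_le h measurable_const) measurable_const ?_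
    fun_prop
  · fun_prop
  · fun_prop

theorem measurable_exclusion (p : Params) (γ : Fin 2 → ℝ≥0∞) (k t : Fin 2) (j : Kind) :
    Measurable fun r : ℝ≥0∞ => exclusion p γ k t r j := by
  cases j <;> unfold exclusion <;> fun_prop

open Classical in
/-- The intensity of the interfering nodes of a given kind in tier `t` at the position `x`. -/
noncomputable def intensityAt (p : Params) (γ : Fin 2 → ℝ≥0∞) (S : Network Ω)
    (μ : Measure Ω) (k t : Fin 2) (j : Kind) (r : ℝ≥0∞) (x : Plane) : ℝ≥0∞ :=
  if exclusion p γ k t r j < ‖x‖ₑ then S.intensity p γ μ k t r j ‖x‖ₑ else 0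

theorem intensityMeasure_eq (p : Params) (γ : Fin 2 → ℝ≥0∞) (S : Network Ω)
    (μ : Measure Ω) (k t : Fin 2) (r : ℝ≥0∞) (j : Kind) :
    S.intensityMeasure p γ μ k t r j = volume.withDensity (S.intensityAt p γ μ k t j r) := rfl

theorem measurable_intensityAt (p : Params) (γ : Fin 2 → ℝ≥0∞) (S : Network Ω)
    (μ : Measure Ω) (k t : Fin 2) (j : Kind) :
    Measurable (Function.uncurry (S.intensityAt p γ μ k t j)) := by
  refine Measurable.ite (measurableSet_lt ?_ (by fun_prop)) ?_ measurable_const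
  · exact (measurable_exclusion p γ k t j).comp measurable_fst
  · exact (measurable_intensity p γ S μ k t j).comp
      (measurable_fst.prodMk (measurable_snd.enorm))

/-- The Laplace exponent, at `s`, of the power received from the interferers of a given tier and
kind. -/
noncomputable def laplaceExponent (p : Params) (γ : Fin 2 → ℝ≥0∞) (S : Network Ω) (μ : Measure Ω)
    (k : Fin 2) (i : Fin 2 × Kind) (s r : ℝ≥0∞) : ℝ≥0∞ :=
  ∫⁻ x, (1 - expNeg (pathExponent p i s x)) ∂S.intensityMeasure p γ μ k i.1 r i.2

theorem measurable_laplaceExponent (p : Params) (γ : Fin 2 → ℝ≥0∞) (S : Network Ω)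
    (μ : Measure Ω) (k : Fin 2) (i : Fin 2 × Kind) {s : ℝ≥0∞ → ℝ≥0∞} (hs : Measurable s) :
    Measurable fun r => laplaceExponent p γ S μ k i (s r) r := by
  have hd := measurable_intensityAt p γ S μ k i.1 i.2
  have hf : Measurable fun q : ℝ≥0∞ × Plane => 1 - expNeg (pathExponent p i (s q.1) q.2) := by
    fun_prop
  have h : (fun r => laplaceExponent p γ S μ k i (s r) r) = fun r => ∫⁻ x : Plane,
      (S.intensityAt p γ μ k i.1 i.2 r * fun x => 1 - expNeg (pathExponent p i (s r) x)) x := by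
    funext r
    have hfr : Measurable fun x => 1 - expNeg (pathExponent p i (s r) x) := by fun_prop
    rw [laplaceExponent, intensityMeasure_eq]
    exact lintegral_withDensity_eq_lintegral_mul _ hd.of_uncurry_left hfr
  rw [h]
  exact (hd.mul hf).lintegral_prod_right'

/-! ### Coverage probability given the distance from the tagged base station -/

/-- The value of the fading above which the SINR exceeds `T`, per unit of noise and
interference. -/
noncomputable def fadingThreshold (p : Params) (k : Fin 2) (T : ℝ≥0) (r : ℝ≥0∞) : ℝ≥0∞ :=
  T / (p.pow k * r ^ (-p.α))

@[fun_prop] theorem measurable_fadingThreshold (p : Params) (k : Fin 2) (T : ℝ≥0) :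
    Measurable (fadingThreshold p k T) := by
  unfold fadingThreshold
  fun_prop

/-- The probability that the SINR of a user of tier `k` at distance `r` from the tagged base station
exceeds `T`, when the interference comes from the nodes of the tiers and kinds in `J`. -/
noncomputable def coverage (p : Params) (γ : Fin 2 → ℝ≥0∞) (S : Network Ω) (μ : Measure Ω)
    (k : Fin 2) (J : Finset (Fin 2 × Kind)) (T : ℝ≥0) (r : ℝ≥0∞) : ℝ≥0∞ :=
  expNeg (fadingThreshold p k T r * p.noise) *
    ∏ i ∈ J, expNeg (laplaceExponent p γ S μ k i (fadingThreshold p k T r) r)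

theorem measurable_coverage (p : Params) (γ : Fin 2 → ℝ≥0∞) (S : Network Ω) (μ : Measure Ω)
    (k : Fin 2) (J : Finset (Fin 2 × Kind)) (T : ℝ≥0) : Measurable (coverage p γ S μ k J T) := by
  unfold coverage
  refine Measurable.mul (by fun_prop) (Finset.measurable_prod _ fun i _ => ?_)
  exact measurable_expNeg.comp (measurable_laplaceExponent p γ S μ k i (by fun_prop))

/-- `N = ∞` is allowed, so finiteness of the interference need not be proved. This is where `T > 0`
matters: for `T = 0` and `N = ∞` the left side is false, while `0 * ∞ = 0` can lie below `h`. -/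
theorem lt_sinr_iff {c h N : ℝ≥0∞} {T : ℝ≥0} (hT : 0 < T) (hc0 : c ≠ 0) (hc : c ≠ ∞)
    (hN : N ≠ 0) : (T : ℝ≥0∞) < c * h / N ↔ T / c * N < h := by
  rw [ENNReal.lt_div_iff_mul_lt (Or.inl hN) (Or.inr (by simpa using hT.ne')), mul_comm c,
    ← ENNReal.div_lt_iff (Or.inl hc0) (Or.inl hc), div_eq_mul_inv, div_eq_mul_inv, mul_right_comm]

theorem HasInterfererLaw.measure_lt_sinr {p : Params} {γ : Fin 2 → ℝ≥0∞}
    {S : Network Ω} {μ : Measure Ω} {k : Fin 2} {r : ℝ≥0∞} {ν : Measure Ω}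
    (h : S.HasInterfererLaw p γ μ k r ν) (hr : r ≠ 0) (J : Finset (Fin 2 × Kind)) {T : ℝ≥0}
    (hT : 0 < T) :
    ν {ω | (T : ℝ≥0∞) < p.pow k * ENNReal.ofReal (S.fading none ω) * r ^ (-p.α) /
      (∑ i ∈ J, S.received p i.1 i.2 ω + p.noise)} = coverage p γ S μ k J T r := by
  have hα : 0 < p.α := two_pos.trans p.two_lt_α
  have hpow : (p.pow k : ℝ≥0∞) ≠ 0 := by exact_mod_cast (p.pow_pos k).ne'
  have hnoise : (p.noise : ℝ≥0∞) ≠ 0 := by exact_mod_cast p.noise_pos.ne'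
  -- At infinite distance no signal arrives and the threshold is `∞`, so both sides are `0`.
  by_cases hr' : r = ∞
  · have h0 : r ^ (-p.α) = 0 := by
      rw [hr', ENNReal.top_rpow_of_neg (neg_lt_zero.2 hα)]
    have ht : fadingThreshold p k T r = ∞ := by
      rw [fadingThreshold, h0, mul_zero, ENNReal.div_zero]
      exact_mod_cast hT.ne'
    rw [coverage, ht, ENNReal.top_mul hnoise]
    simp [h0]
  have := h.indep_fading.isProbabilityMeasure
  have hc0 : (p.pow k : ℝ≥0∞) * r ^ (-p.α) ≠ 0 :=
    mul_ne_zero hpow (ENNReal.rpow_pos (pos_iff_ne_zero.2 hr) hr').ne'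
  have hc : (p.pow k : ℝ≥0∞) * r ^ (-p.α) ≠ ∞ := by
    refine ENNReal.mul_ne_top ENNReal.coe_ne_top ?_
    rw [ENNReal.rpow_neg]
    exact ENNReal.inv_ne_top.2 (ENNReal.rpow_pos (pos_iff_ne_zero.2 hr) hr').ne'
  have hset : {ω | (T : ℝ≥0∞) < p.pow k * ENNReal.ofReal (S.fading none ω) * r ^ (-p.α) /
      (∑ i ∈ J, S.received p i.1 i.2 ω + p.noise)} =
      {ω | fadingThreshold p k T r * p.noise +
        fadingThreshold p k T r * ∑ i ∈ J, S.received p i.1 i.2 ω <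
        ENNReal.ofReal (S.fading none ω)} := by
    ext ω
    rw [Set.mem_ofPred_eq, Set.mem_ofPred_eq, mul_right_comm, lt_sinr_iff hT hc0 hc
      (by simp [hnoise]), ← fadingThreshold, ← mul_add, add_comm]
  rw [hset, h.measure_add_sum_received_lt, coverage]
  congr 1
  refine Finset.prod_congr rfl fun i _ => ?_
  have hm : Measurable fun x => pathExponent p i (fadingThreshold p k T r) x := by
    fun_prop
  exact (h.poisson i.1 i.2).lintegral_expNeg_sumPoints hm

end Network

/-! ### Distances of the closest base stations -/

namespace PointProcess

variable {Ω : Type*} [MeasurableSpace Ω]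

/-- The open disc of radius `r ∈ [0, ∞]` around the typical user. -/
def disc (r : ℝ≥0∞) : Set Plane := {x | ‖x‖ₑ < r}

theorem measurableSet_disc (r : ℝ≥0∞) : MeasurableSet (disc r) :=
  measurableSet_lt (by fun_prop) measurable_const

theorem volume_disc_ne_top {r : ℝ≥0∞} (hr : r ≠ ∞) : volume (disc r) ≠ ∞ := by
  refine ne_top_of_le_ne_top
    (measure_ball_lt_top (μ := volume) (x := (0 : Plane)) (r := r.toReal)).ne
    (measure_mono fun x hx => ?_)
  rw [mem_ball_zero_iff, ← toReal_enorm]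
  exact (ENNReal.toReal_lt_toReal enorm_ne_top hr).2 hx

theorem le_nearest_iff (X : PointProcess Ω) (r : ℝ≥0∞) (ω : Ω) :
    r ≤ X.nearest ω ↔ X.numIn (disc r) ω = 0 := by
  simp [numIn_eq_zero_iff, nearest, disc]

open Classical in
theorem measurable_configNearest :
    Measurable fun c : ℕ∞ × (ℕ → Plane) => ⨅ (n : ℕ) (_ : (n : ℕ∞) < c.1), ‖c.2 n‖ₑ := by
  simp_rw [iInf_eq_if]
  refine Measurable.iInf fun n => Measurable.ite ?_ (by fun_prop) measurable_const
  exact measurable_fst (MeasurableSet.of_discrete (s := Set.Ioi (n : ℕ∞)))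

theorem measurable_nearest (X : PointProcess Ω) : Measurable X.nearest :=
  measurable_configNearest.comp X.measurable_config

namespace IsPoisson

variable {X : PointProcess Ω} {μ : Measure Ω}

/-- The void probabilities of a Poisson process. -/
theorem measure_numIn_eq_zero {Λ : Measure Plane} (hX : X.IsPoisson Λ μ) {B : Set Plane}
    (hB : MeasurableSet B) (hΛ : Λ B ≠ ∞) : μ {ω | X.numIn B ω = 0} = expNeg (Λ B) := by
  have h := hX.lintegral_expNeg_numIn hB hΛ ∞
  have hm : MeasurableSet {ω | X.numIn B ω = 0} := X.measurable_numIn hB (measurableSet_singleton 0)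
  have h1 : ∀ ω, expNeg (∞ * X.numIn B ω) = {ω | X.numIn B ω = 0}.indicator 1 ω := fun ω => by
    by_cases h0 : X.numIn B ω = 0
    · simp [h0]
    · simp [h0, ENNReal.top_mul]
  simp_rw [h1] at h
  rwa [lintegral_indicator_one hm, expNeg_top, tsub_zero, one_mul] at h

variable {d : ℝ≥0}

theorem measure_le_nearest (hX : X.IsPoisson ((d : ℝ≥0∞) • volume) μ) {r : ℝ≥0∞} (hr : r ≠ ∞) :
    μ {ω | r ≤ X.nearest ω} = expNeg (d * volume (disc r)) := by
  simp_rw [le_nearest_iff]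
  rw [hX.measure_numIn_eq_zero (measurableSet_disc r)]
  · simp
  · simpa using ENNReal.mul_ne_top ENNReal.coe_ne_top (volume_disc_ne_top hr)

/-- The tails of the distance are void probabilities of discs. The tail at `∞` follows by continuity
from above, since the count on a set of infinite intensity is not prescribed. -/
theorem map_nearest_eq [IsFiniteMeasure μ] (hX : X.IsPoisson ((d : ℝ≥0∞) • volume) μ)
    {Ω' : Type*} [MeasurableSpace Ω'] {Y : PointProcess Ω'} {μ' : Measure Ω'} [IsFiniteMeasure μ']
    (hY : Y.IsPoisson ((d : ℝ≥0∞) • volume) μ') : μ.map X.nearest = μ'.map Y.nearest := by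
  have hfin : ∀ r : ℝ≥0∞, r ≠ ∞ →
      μ.map X.nearest (Set.Ici r) = μ'.map Y.nearest (Set.Ici r) := fun r hr => by
    rw [Measure.map_apply X.measurable_nearest measurableSet_Ici,
      Measure.map_apply Y.measurable_nearest measurableSet_Ici]
    exact (hX.measure_le_nearest hr).trans (hY.measure_le_nearest hr).symm
  refine Measure.ext_of_Ici _ _ fun r => ?_
  by_cases hr : r = ∞
  · have h : Set.Ici r = ⋂ n : ℕ, Set.Ici (n : ℝ≥0∞) := by
      ext x
      simp only [hr, Set.mem_Ici, top_le_iff, Set.mem_iInter]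
      refine ⟨fun h n => h ▸ le_top, fun h => ENNReal.eq_top_of_forall_nnreal_le fun q => ?_⟩
      obtain ⟨n, hn⟩ := exists_nat_ge q
      exact le_trans (by exact_mod_cast hn) (h n)
    have ha : Antitone fun n : ℕ => Set.Ici (n : ℝ≥0∞) := fun a b hab =>
      Set.Ici_subset_Ici.2 (by exact_mod_cast hab)
    rw [h, ha.measure_iInter (fun _ => measurableSet_Ici.nullMeasurableSet)
      ⟨0, measure_ne_top _ _⟩, ha.measure_iInter (fun _ => measurableSet_Ici.nullMeasurableSet)
      ⟨0, measure_ne_top _ _⟩]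
    exact iInf_congr fun n => hfin n (ENNReal.natCast_ne_top n)
  · exact hfin r hr

/-- Shrinking discs are used instead of the single point `0` because the infimum defining the
distance could vanish without being attained. -/
theorem ae_nearest_ne_zero [IsProbabilityMeasure μ]
    (hX : X.IsPoisson ((d : ℝ≥0∞) • volume) μ) : ∀ᵐ ω ∂μ, X.nearest ω ≠ 0 := by
  let s : ℕ → ℝ≥0∞ := fun n => ((n : ℝ≥0∞) + 1)⁻¹
  have hs0 : ∀ n, s n ≠ 0 := fun n => by simp [s]
  have hs : ∀ n, s n ≠ ∞ := fun n => by simp [s]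
  have hanti : Antitone fun n => disc (s n) := fun a b hab x hx =>
    lt_of_lt_of_le hx (ENNReal.inv_le_inv.2 (by gcongr))
  have hlim : Filter.Tendsto (fun n => volume (disc (s n))) Filter.atTop (nhds 0) := by
    have h := tendsto_measure_iInter_atTop (μ := (volume : Measure Plane))
      (fun n => (measurableSet_disc (s n)).nullMeasurableSet) hanti
      ⟨0, volume_disc_ne_top (hs 0)⟩
    have h0 : ⋂ n, disc (s n) ⊆ {0} := fun x hx => by
      by_contra hne
      obtain ⟨n, hn⟩ := ENNReal.exists_inv_nat_lt (a := ‖x‖ₑ) (by simpa using hne)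
      have h1 : ‖x‖ₑ < s n := Set.mem_iInter.1 hx n
      exact (h1.trans_le (ENNReal.inv_le_inv.2 le_self_add)).not_gt hn
    rwa [measure_mono_null h0 (measure_singleton 0)] at h
  have hle : ∀ n, μ {ω | X.nearest ω = 0} ≤ 1 - expNeg (d * volume (disc (s n))) := fun n => by
    have hm : MeasurableSet {ω | s n ≤ X.nearest ω} := X.measurable_nearest measurableSet_Ici
    rw [← hX.measure_le_nearest (hs n), ← prob_compl_eq_one_sub hm]
    refine measure_mono fun ω hω => ?_
    simp only [Set.mem_ofPred_eq] at hω
    simp [hω, hs0 n]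
  have hlim' : Filter.Tendsto (fun n => 1 - expNeg (d * volume (disc (s n)))) Filter.atTop
      (nhds 0) := by
    have h := ENNReal.Tendsto.const_mul (a := (d : ℝ≥0∞)) hlim (Or.inr ENNReal.coe_ne_top)
    rw [mul_zero] at h
    have h2 := ENNReal.Tendsto.sub (tendsto_const_nhds (x := (1 : ℝ≥0∞)))
      ((continuous_expNeg.tendsto 0).comp h) (Or.inl ENNReal.one_ne_top)
    simpa using h2
  have h0 := ge_of_tendsto' hlim' hle
  rw [ae_iff]
  simpa using h0

end IsPoisson

end PointProcess

namespace Network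

variable {Ω : Type*} [MeasurableSpace Ω]

theorem measurable_dist (S : Network Ω) (k : Fin 2) : Measurable (S.dist k) :=
  (S.bs k).measurable_nearest

/-- The law of the distances from the typical user to the closest base stations of the two
tiers. -/
noncomputable def distLaw (S : Network Ω) (μ : Measure Ω) : Measure (Fin 2 → ℝ≥0∞) :=
  μ.map fun ω k => S.dist k ω

theorem measurable_dists (S : Network Ω) : Measurable fun ω k => S.dist k ω :=
  measurable_pi_lambda _ S.measurable_dist

namespace IsModel

variable [StandardBorelSpace Ω] {p : Params} {γ : Fin 2 → ℝ≥0∞} {S : Network Ω} {μ : Measure Ω}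

theorem ae_dist_ne_zero [IsProbabilityMeasure μ] (hS : S.IsModel p γ μ) (k : Fin 2) :
    ∀ᵐ ω ∂μ, S.dist k ω ≠ 0 := (hS.poisson_bs k).ae_nearest_ne_zero

theorem distLaw_eq_map_prod [IsProbabilityMeasure μ] (hS : S.IsModel p γ μ) :
    S.distLaw μ = ((μ.map (S.dist 0)).prod (μ.map (S.dist 1))).map fun q => ![q.1, q.2] := by
  have hi : IndepFun (S.dist 0) (S.dist 1) μ :=
    hS.indep_bs.comp PointProcess.measurable_configNearest PointProcess.measurable_configNearest
  rw [← hi.map_prod_eq_prod_map_map (S.measurable_dist 0).aemeasurable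
    (S.measurable_dist 1).aemeasurable, Measure.map_map ?_
    ((S.measurable_dist 0).prodMk (S.measurable_dist 1)), distLaw]
  · congr 1
    funext ω k
    fin_cases k <;> rfl
  · refine measurable_pi_lambda _ fun k => ?_
    fin_cases k
    exacts [measurable_fst, measurable_snd]

/-- The law of the distances of the closest base stations depends on the parameters only. -/
theorem distLaw_eq [IsProbabilityMeasure μ] (hS : S.IsModel p γ μ) {Ω' : Type*}
    [MeasurableSpace Ω'] [StandardBorelSpace Ω'] {γ' : Fin 2 → ℝ≥0∞} {S' : Network Ω'}
    {μ' : Measure Ω'} [IsProbabilityMeasure μ'] (hS' : S'.IsModel p γ' μ') :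
    S.distLaw μ = S'.distLaw μ' := by
  have h : ∀ k, μ.map (S.dist k) = μ'.map (S'.dist k) := fun k =>
    (hS.poisson_bs k).map_nearest_eq (hS'.poisson_bs k)
  rw [hS.distLaw_eq_map_prod, hS'.distLaw_eq_map_prod, h, h]

end IsModel

end Network

/-! ### Conditioning on events, and thresholds decreasing to zero -/

theorem cond_congr_set {Ω : Type*} [MeasurableSpace Ω] {μ : Measure Ω} {s t : Set Ω}
    (h : s =ᵐ[μ] t) : cond μ s = cond μ t := by
  rw [ProbabilityTheory.cond, ProbabilityTheory.cond, measure_congr h, Measure.restrict_congr_set h]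

theorem lintegral_comp_cond_preimage {Ω β : Type*} [MeasurableSpace Ω] [MeasurableSpace β]
    {μ : Measure Ω} {f : Ω → β} (hf : Measurable f) {V : Set β} (hV : MeasurableSet V)
    {g : β → ℝ≥0∞} (hg : Measurable g) :
    ∫⁻ ω, g (f ω) ∂(cond μ (f ⁻¹' V)) = ∫⁻ q, g q ∂(cond (μ.map f) V) := by
  rw [ProbabilityTheory.cond, ProbabilityTheory.cond, lintegral_smul_measure, lintegral_smul_measure, Measure.restrict_map hf hV,
    lintegral_map hg hf, Measure.map_apply hf hV]

theorem measure_pos_eq_iSup {Ω : Type*} [MeasurableSpace Ω] (μ : Measure Ω) (θ : Ω → ℝ≥0∞) :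
    μ {ω | 0 < θ ω} = ⨆ n : ℕ, μ {ω | (((n : ℝ≥0) + 1)⁻¹ : ℝ≥0) < θ ω} := by
  have hmono : Monotone fun n : ℕ => {ω | ((((n : ℝ≥0) + 1)⁻¹ : ℝ≥0) : ℝ≥0∞) < θ ω} := by
    intro a b hab ω hω
    refine lt_of_le_of_lt (ENNReal.coe_le_coe.2 ?_) hω
    gcongr
  rw [← hmono.measure_iUnion]
  congr 1
  ext ω
  simp only [Set.mem_ofPred_eq, Set.mem_iUnion]
  refine ⟨fun h => ?_, fun ⟨n, hn⟩ => pos_of_gt hn⟩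
  obtain ⟨x, hx0, hx⟩ := ENNReal.lt_iff_exists_nnreal_btwn.1 h
  obtain ⟨n, hn⟩ := exists_nat_one_div_lt (K := ℝ≥0) (by exact_mod_cast hx0 : 0 < x)
  refine ⟨n, lt_trans (ENNReal.coe_lt_coe.2 ?_) hx⟩
  rwa [← one_div]

namespace Params

/-- The values of the distances of the closest base stations for which the typical user belongs to
tier `k`. -/
def tierRegion (p : Params) (k : Fin 2) : Set (Fin 2 → ℝ≥0∞) :=
  {q | q k ≤ q k.rev * p.ratio k k.rev}

theorem measurableSet_tierRegion (p : Params) (k : Fin 2) : MeasurableSet (p.tierRegion k) :=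
  measurableSet_le (by fun_prop) (by fun_prop)

theorem fullRadius_zero (p : Params) (t : Fin 2) : p.fullRadius (fun _ => 0) t = ∞ := by
  have hpow : (p.pow t : ℝ≥0∞) ≠ 0 := by exact_mod_cast (p.pow_pos t).ne'
  have hα : 0 < p.α := two_pos.trans p.two_lt_α
  rw [fullRadius, ENNReal.div_zero hpow, ENNReal.top_rpow_of_pos (by positivity)]

theorem fullRadius_top (p : Params) (t : Fin 2) : p.fullRadius (fun _ => ∞) t = 0 := by
  have hα : 0 < p.α := two_pos.trans p.two_lt_α
  rw [fullRadius, ENNReal.div_top, ENNReal.zero_rpow_of_pos (by positivity)]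

end Params

/-! ### The SINR distribution as an integral against the law of the distances -/

namespace Network

variable {Ω : Type*} [MeasurableSpace Ω]

/-- The SINR of a user of tier `k` when the interference comes from the nodes of the tiers and
kinds in `J`. -/
noncomputable def sinr (p : Params) (S : Network Ω) (J : Finset (Fin 2 × Kind)) (k : Fin 2)
    (ω : Ω) : ℝ≥0∞ :=
  S.signal p k ω / (∑ i ∈ J, S.received p i.1 i.2 ω + p.noise)

theorem inTier_eq_preimage (p : Params) (S : Network Ω) (k : Fin 2) :
    S.inTier p k = (fun ω k => S.dist k ω) ⁻¹' p.tierRegion k := rfl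

theorem measure_inTier (p : Params) (S : Network Ω) (μ : Measure Ω) (k : Fin 2) :
    μ (S.inTier p k) = S.distLaw μ (p.tierRegion k) := by
  rw [inTier_eq_preimage, distLaw, Measure.map_apply S.measurable_dists
    (p.measurableSet_tierRegion k)]

namespace IsModel

variable [StandardBorelSpace Ω] {p : Params} {γ : Fin 2 → ℝ≥0∞} {S : Network Ω} {μ : Measure Ω}
  [IsProbabilityMeasure μ]

theorem cond_lt_sinr (hS : S.IsModel p γ μ) (k : Fin 2) (m : Duplex) (J : Finset (Fin 2 × Kind))
    {T : ℝ≥0} (hT : 0 < T) :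
    cond μ (S.inMode p γ k m) {ω | (T : ℝ≥0∞) < S.sinr p J k ω} =
      ∫⁻ ω, coverage p γ S μ k J T (S.dist k ω) ∂(cond μ (S.inMode p γ k m)) := by
  -- The distance to the tagged base station becomes a separate coordinate, so that it can be frozen
  -- in the disintegration.
  let A : Set (ℝ≥0∞ × Ω) := {q | (T : ℝ≥0∞) < p.pow k * ENNReal.ofReal (S.fading none q.2) *
    q.1 ^ (-p.α) / (∑ i ∈ J, S.received p i.1 i.2 q.2 + p.noise)}
  have hA : MeasurableSet A := by
    have h1 := S.measurable_fading none
    have h2 := fun i : Fin 2 × Kind => S.measurable_received p i.1 i.2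
    exact measurableSet_lt measurable_const (by fun_prop)
  refine (measure_eq_lintegral_condExpKernel _ (S.measurable_dist k) hA).trans ?_
  refine lintegral_congr_ae ?_
  filter_upwards [hS.interferers k m,
    cond_absolutelyContinuous.ae_le (hS.ae_dist_ne_zero k)] with ω h1 h2
  exact h1.measure_lt_sinr h2 J hT

/-- When the mode is automatic, the conditioning event is association with tier `k`, which is
determined by the two distances, so the average can be pushed forward to their joint law. -/
theorem cond_lt_sinr_eq_lintegral_distLaw (hS : S.IsModel p γ μ) {k : Fin 2} {m : Duplex}
    (hm : S.inMode p γ k m =ᵐ[μ] S.inTier p k) (J : Finset (Fin 2 × Kind)) {T : ℝ≥0}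
    (hT : 0 < T) :
    cond μ (S.inMode p γ k m) {ω | (T : ℝ≥0∞) < S.sinr p J k ω} =
      ∫⁻ q, coverage p γ S μ k J T (q k) ∂(cond (S.distLaw μ) (p.tierRegion k)) := by
  rw [hS.cond_lt_sinr k m J hT, cond_congr_set hm, inTier_eq_preimage]
  exact lintegral_comp_cond_preimage (g := fun q => coverage p γ S μ k J T (q k))
    S.measurable_dists (p.measurableSet_tierRegion k)
    ((measurable_coverage p γ S μ k J T).comp (measurable_pi_apply k))

/-- Two networks with the same parameters in which all users of tier `k` are in a given mode have
the same SINR distribution if their coverage probabilities given the distance agree. -/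
theorem cond_lt_sinr_congr (hS : S.IsModel p γ μ) {Ω' : Type*}
    [MeasurableSpace Ω'] [StandardBorelSpace Ω'] {γ' : Fin 2 → ℝ≥0∞} {S' : Network Ω'}
    {μ' : Measure Ω'} [IsProbabilityMeasure μ'] (hS' : S'.IsModel p γ' μ') {k : Fin 2}
    {m m' : Duplex} (hm : S.inMode p γ k m =ᵐ[μ] S.inTier p k)
    (hm' : S'.inMode p γ' k m' =ᵐ[μ'] S'.inTier p k) {J J' : Finset (Fin 2 × Kind)}
    (hJ : ∀ T r, coverage p γ S μ k J T r = coverage p γ' S' μ' k J' T r) (T : ℝ≥0) :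
    cond μ (S.inMode p γ k m) {ω | (T : ℝ≥0∞) < S.sinr p J k ω} =
      cond μ' (S'.inMode p γ' k m') {ω | (T : ℝ≥0∞) < S'.sinr p J' k ω} := by
  have hpos : ∀ T : ℝ≥0, 0 < T →
      cond μ (S.inMode p γ k m) {ω | (T : ℝ≥0∞) < S.sinr p J k ω} =
        cond μ' (S'.inMode p γ' k m') {ω | (T : ℝ≥0∞) < S'.sinr p J' k ω} := fun T hT => by
    rw [hS.cond_lt_sinr_eq_lintegral_distLaw hm J hT,
      hS'.cond_lt_sinr_eq_lintegral_distLaw hm' J' hT, hS.distLaw_eq hS']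
    simp_rw [hJ]
  rcases eq_or_ne T 0 with rfl | hT
  · rw [ENNReal.coe_zero, measure_pos_eq_iSup, measure_pos_eq_iSup]
    exact iSup_congr fun n => hpos _ (by positivity)
  · exact hpos T (pos_iff_ne_zero.2 hT)

end IsModel

/-! ### Only full-duplex users -/

theorem inMode_full_zero (p : Params) (S : Network Ω) (k : Fin 2) :
    S.inMode p (fun _ => 0) k .full = S.inTier p k := by
  ext ω
  simp [inMode, p.fullRadius_zero]

theorem modeDens_half_zero (p : Params) (S : Network Ω) (μ : Measure Ω) (t : Fin 2) :
    S.modeDens p (fun _ => 0) μ t .half = 0 := by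
  have : S.inMode p (fun _ => 0) t .half = ∅ := by
    ext ω
    simp [inMode, p.fullRadius_zero]
  simp [modeDens, this]

/-! ### Only half-duplex users -/

theorem IsModel.inMode_half_top [StandardBorelSpace Ω] {p : Params} {γ : Fin 2 → ℝ≥0∞}
    {S : Network Ω} {μ : Measure Ω} [IsProbabilityMeasure μ] (hS : S.IsModel p γ μ) (k : Fin 2) :
    S.inMode p (fun _ => ∞) k .half =ᵐ[μ] S.inTier p k := by
  rw [Filter.eventuallyEq_set]
  filter_upwards [hS.ae_dist_ne_zero k] with ω h
  simp [inMode, p.fullRadius_top, pos_iff_ne_zero, h]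

theorem IsModel.modeDens_full_top [StandardBorelSpace Ω] {p : Params} {γ : Fin 2 → ℝ≥0∞}
    {S : Network Ω} {μ : Measure Ω} [IsProbabilityMeasure μ] (hS : S.IsModel p γ μ) (t : Fin 2) :
    S.modeDens p (fun _ => ∞) μ t .full = 0 := by
  have : μ (S.inMode p (fun _ => ∞) t .full) = 0 := by
    refine measure_mono_null (fun ω h => ?_) (ae_iff.1 (hS.ae_dist_ne_zero t))
    have h2 := h.2
    rw [p.fullRadius_top] at h2
    simpa using h2
  simp [modeDens, this]

/-! ### Comparison -/

theorem laplaceExponent_eq_zero {p : Params} {γ : Fin 2 → ℝ≥0∞} {S : Network Ω} {μ : Measure Ω}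
    {k : Fin 2} {i : Fin 2 × Kind} {r : ℝ≥0∞}
    (h : ∀ y, S.intensity p γ μ k i.1 r i.2 y = 0) (s : ℝ≥0∞) :
    laplaceExponent p γ S μ k i s r = 0 := by
  have : S.intensityMeasure p γ μ k i.1 r i.2 = 0 := by
    rw [intensityMeasure]
    simp [h]
  rw [laplaceExponent, this, lintegral_zero_measure]

section Comparison

variable [StandardBorelSpace Ω] {p : Params} {F : Network Ω} {μ₁ : Measure Ω}
  [IsProbabilityMeasure μ₁] {Ω' : Type*} [MeasurableSpace Ω'] [StandardBorelSpace Ω']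
  {H : Network Ω'} {μ₂ : Measure Ω'} [IsProbabilityMeasure μ₂]

theorem measure_inTier_eq {γ γ' : Fin 2 → ℝ≥0∞} (hF : F.IsModel p γ μ₁) (hH : H.IsModel p γ' μ₂)
    (k : Fin 2) : μ₁ (F.inTier p k) = μ₂ (H.inTier p k) := by
  rw [measure_inTier, measure_inTier, hF.distLaw_eq hH]

theorem measure_inMode_full_eq_half (hF : F.IsModel p (fun _ => 0) μ₁)
    (hH : H.IsModel p (fun _ => ∞) μ₂) (k : Fin 2) :
    μ₁ (F.inMode p (fun _ => 0) k .full) = μ₂ (H.inMode p (fun _ => ∞) k .half) := by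
  rw [inMode_full_zero, measure_congr (hH.inMode_half_top k), measure_inTier_eq hF hH]

theorem intensityMeasure_bsFull_eq_bsHalf (hF : F.IsModel p (fun _ => 0) μ₁)
    (hH : H.IsModel p (fun _ => ∞) μ₂) (k t : Fin 2) (r : ℝ≥0∞) :
    F.intensityMeasure p (fun _ => 0) μ₁ k t r .bsFull =
      H.intensityMeasure p (fun _ => ∞) μ₂ k t r .bsHalf := by
  have hd : F.modeDens p (fun _ => 0) μ₁ t .full = H.modeDens p (fun _ => ∞) μ₂ t .half := by
    rw [modeDens, modeDens, measure_inMode_full_eq_half hF hH, measure_inTier_eq hF hH]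
  have h : ∀ y, F.intensity p (fun _ => 0) μ₁ k t r .bsFull y =
      H.intensity p (fun _ => ∞) μ₂ k t r .bsHalf y := fun y => by
    simp only [intensity, hd, p.fullRadius_top]
    split_ifs with h0
    -- With `δ = 0` the cutoff removes only `ζ = 0`, where the factor `1 - exp (-λ_u π ζ²)` vanishes
    -- anyway.
    · simp [nonpos_iff_eq_zero.1 h0]
    · simp
  unfold intensityMeasure
  simp_rw [h]
  rfl

noncomputable instance : DecidableEq Kind := Classical.decEq _

open Finset in
-- The two values of `j` are the two channels: either half-duplex kind has zero intensity in the
-- all-full-duplex network, so the channels do not differ. In the other network both full-duplex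
-- kinds have zero intensity, so its full-duplex users need not be omitted by hand.
theorem coverage_bsFull_pair (hF : F.IsModel p (fun _ => 0) μ₁)
    (hH : H.IsModel p (fun _ => ∞) μ₂) {j : Kind} (hj : j = .bsHalf ∨ j = .userHalf)
    (k : Fin 2) (T : ℝ≥0) (r : ℝ≥0∞) :
    coverage p (fun _ => 0) F μ₁ k (univ ×ˢ {.bsFull, j}) T r =
      coverage p (fun _ => ∞) H μ₂ k (univ ×ˢ {.bsFull, .userFull, .bsHalf}) T r := by
  unfold coverage
  congr 1
  rw [prod_product, prod_product]
  refine prod_congr rfl fun t _ => ?_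
  have hne : Kind.bsFull ≠ j := by rcases hj with rfl | rfl <;> nofun
  have hj0 : ∀ s, laplaceExponent p (fun _ => 0) F μ₁ k (t, j) s r = 0 :=
    laplaceExponent_eq_zero fun y => by
      rcases hj with rfl | rfl
      · simp [intensity, p.fullRadius_zero]
      · simp [intensity, modeDens_half_zero]
  have hb0 : ∀ s, laplaceExponent p (fun _ => ∞) H μ₂ k (t, .bsFull) s r = 0 :=
    laplaceExponent_eq_zero fun y => by simp [intensity, hH.modeDens_full_top]
  have hu0 : ∀ s, laplaceExponent p (fun _ => ∞) H μ₂ k (t, .userFull) s r = 0 :=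
    laplaceExponent_eq_zero fun y => by simp [intensity, hH.modeDens_full_top]
  rw [prod_pair hne, prod_insert (by simp), prod_pair (by simp), hj0, hb0, hu0, expNeg_zero,
    mul_one, one_mul, one_mul]
  simp only [laplaceExponent]
  rw [intensityMeasure_bsFull_eq_bsHalf hF hH]
  -- The path exponents agree because both kinds of base stations in tier `t` transmit with power
  -- `p.pow t`.
  rfl

end Comparison

/-! ### The SINRs as instances of `sinr` for sets of interfering kinds -/

open Finset in
theorem sinrFull1_eq (p : Params) (h : p.rsiUser = 0) (S : Network Ω) (k : Fin 2) (ω : Ω) :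
    S.sinrFull1 p false k ω = S.sinr p (univ ×ˢ {.bsFull, .bsHalf}) k ω := by
  simp [sinrFull1, sinr, interference1, h, sum_product]

open Finset in
theorem sinrFull2_eq (p : Params) (h : p.rsiUser = 0) (S : Network Ω) (k : Fin 2) (ω : Ω) :
    S.sinrFull2 p false k ω = S.sinr p (univ ×ˢ {.bsFull, .userHalf}) k ω := by
  simp [sinrFull2, sinr, interference2, h, sum_product]

open Finset in
theorem sinrHalf1_eq (p : Params) (S : Network Ω) (k : Fin 2) (ω : Ω) :
    S.sinrHalf1 p k ω = S.sinr p (univ ×ˢ {.bsFull, .userFull, .bsHalf}) k ω := by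
  simp [sinrHalf1, sinr, interference1, sum_product, add_assoc]

end Network

end HetNet

theorem corollary2
    (p : HetNet.Params)
    (h_sic : (∀ k, p.rsi k = 0) ∧ p.rsiUser = 0)
    {Ω₁ Ω₂ : Type*} [MeasurableSpace Ω₁] [StandardBorelSpace Ω₁]
    [MeasurableSpace Ω₂] [StandardBorelSpace Ω₂]
    (μ₁ : Measure Ω₁) [IsProbabilityMeasure μ₁] (μ₂ : Measure Ω₂) [IsProbabilityMeasure μ₂]
    (F : HetNet.Network Ω₁) (hF : F.IsModel p (fun _ => 0) μ₁)
    (H : HetNet.Network Ω₂) (hH : H.IsModel p (fun _ => ∞) μ₂)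
    (T : ℝ≥0) :
    (∀ k,
      F.tierDistribution p (fun _ => 0) μ₁ .full (F.sinrFull1 p false) k T =
        H.tierDistribution p (fun _ => ∞) μ₂ .half (H.sinrHalf1 p) k T ∧
      F.tierDistribution p (fun _ => 0) μ₁ .full (F.sinrFull2 p false) k T =
        H.tierDistribution p (fun _ => ∞) μ₂ .half (H.sinrHalf1 p) k T) ∧
    F.distribution p (fun _ => 0) μ₁ .full (F.sinrFull1 p false) T =
      H.distribution p (fun _ => ∞) μ₂ .half (H.sinrHalf1 p) T ∧
    F.distribution p (fun _ => 0) μ₁ .full (F.sinrFull2 p false) T =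
      H.distribution p (fun _ => ∞) μ₂ .half (H.sinrHalf1 p) T := by
  have hmode : ∀ k, F.inMode p (fun _ => 0) k .full =ᵐ[μ₁] F.inTier p k := fun k =>
    .of_eq (HetNet.Network.inMode_full_zero p F k)
  have h1 : ∀ k, F.tierDistribution p (fun _ => 0) μ₁ .full (F.sinrFull1 p false) k T =
      H.tierDistribution p (fun _ => ∞) μ₂ .half (H.sinrHalf1 p) k T := fun k => by
    simp only [HetNet.Network.tierDistribution, HetNet.Network.sinrFull1_eq p h_sic.2,
      HetNet.Network.sinrHalf1_eq, measureReal_def]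
    rw [hF.cond_lt_sinr_congr hH (hmode k) (hH.inMode_half_top k) fun T r =>
      HetNet.Network.coverage_bsFull_pair hF hH (Or.inl rfl) k T r]
  have h2 : ∀ k, F.tierDistribution p (fun _ => 0) μ₁ .full (F.sinrFull2 p false) k T =
      H.tierDistribution p (fun _ => ∞) μ₂ .half (H.sinrHalf1 p) k T := fun k => by
    simp only [HetNet.Network.tierDistribution, HetNet.Network.sinrFull2_eq p h_sic.2,
      HetNet.Network.sinrHalf1_eq, measureReal_def]
    rw [hF.cond_lt_sinr_congr hH (hmode k) (hH.inMode_half_top k) fun T r =>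
      HetNet.Network.coverage_bsFull_pair hF hH (Or.inr rfl) k T r]
  -- The averages over the tiers also require equal weights: both are the probability of association
  -- with tier `k`.
  have hA : ∀ k, μ₁.real (F.inMode p (fun _ => 0) k .full) =
      μ₂.real (H.inMode p (fun _ => ∞) k .half) := fun k => by
    rw [measureReal_def, measureReal_def, HetNet.Network.measure_inMode_full_eq_half hF hH]
  refine ⟨fun k => ⟨h1 k, h2 k⟩, ?_, ?_⟩
  · simp only [HetNet.Network.distribution, h1, hA]
  · simp only [HetNet.Network.distribution, h2, hA]
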